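/- **Theorem (expected boundary size).** Setting. Let $(G_n)_{n\ge 1}$ be a sequence of finite (simple) vertex-transitive graphs, where $G_n$ has $V_n$ vertices, degree $m_n$ and a marked vertex $0$. For $p\in[0,1]$ let $G_{n,p}$ be the random subgraph in which each edge of $G_n$ is retained (open) independently with probability $p$; let $\mathcal C(0)$ be the connected component of $0$ in $G_{n,p}$, and let $p_c=p_c(n)\in[0,1]$ be the solution of $$\mathbb E_{p_c}|\mathcal C(0)|=\tfrac1{10}V_n^{1/3}$$ (assumed to exist for every $n$). Let $\mathbf p^t(x,y)$ be the probability that the non-backtracking random walk on $G_n$ started at $x$ is at $y$ after $t$ steps (so $\mathbf p^0(x,y)=\mathbf 1_{\{x=y\}}$, the first step is to a uniform neighbour, and each later step is uniform among the $m_n-1$ neighbours other than the one the walk has just come from), and for $\xi\ge0$ let $$T_{\rm mix}(\xi)=\min\Big\{t\ge 0:\ \max_{x,y}\frac{\mathbf p^t(x,y)+\mathbf p^{t+1}(x,y)}2\le \frac{1+\xi}{V_n}\Big\}.$$ Assumptions. There is a sequence $\alpha_n\to0$ with $\alpha_n\ge 1/m_n$ such that $m_0=m_0(n):=T_{\rm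 mix}(\alpha_n)$ is finite for every $n$ and, as $n\to\infty$, 1. $m_n\to\infty$; 2. $[p_c(m_n-1)]^{m_0}=1+O(\alpha_n)$; 3. uniformly over all vertices $x,y$ of $G_n$, $$\sum_{u,v}\ \sum_{\substack{0\le t_1,t_2,t_3\le m_0\\ t_1+t_2+t_3\ge3}}\mathbf p^{t_1}(x,u)\,\mathbf p^{t_2}(u,v)\,\mathbf p^{t_3}(v,y)=O\big(\alpha_n/\log V_n\big).$$ Conclusion. For a set $A$ of vertices and an integer $r\ge0$, let $\partial B(r;A)$ be the set of vertices whose graph distance from $0$ is exactly $r$ in the graph obtained from $G_{n,p}$ by deleting all edges that touch $A$. Then there is a constant $C>0$ (not depending on $n$, $r$ or $A$) such that for every $n$, every integer $r\ge0$ and every set $A$ of vertices of $G_n$, $$\mathbb E_{p_c}\,|\partial B(r;A)|\le C .$$ Equivalently, $\max_{A}\mathbb E_{p_c}|\partial B(r;A)|\le C$ for all $r$. -/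

import Mathlib

open Filter Asymptotics Topology

namespace Perc

/-- The expectation `E_p [X]` of an observable `X` of the random graph `G_p`, in which every edge
of the finite graph `G` is retained independently with probability `p`.  The open subgraph with
set of open edges `S` has probability `p ^ |S| * (1 - p) ^ |E(G) \ S|`. -/
noncomputable def expect {V : Type*} [Fintype V] (G : SimpleGraph V) (p : ℝ)
    (X : SimpleGraph V → ℝ) : ℝ :=
  open Classical in
  ∑ S ∈ G.edgeFinset.powerset,
    p ^ S.card * (1 - p) ^ (G.edgeFinset \ S).card *
      X (SimpleGraph.fromEdgeSet (S : Set (Sym2 V)))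

/-- The connected component (cluster) of `x` in the open subgraph `ω`. -/
def cluster {V : Type*} (ω : SimpleGraph V) (x : V) : Set V :=
  {y | ω.Reachable x y}

/-- The expected cluster size `χ(p) = E_p |C(x)|`. -/
noncomputable def expectedClusterSize {V : Type*} [Fintype V] (G : SimpleGraph V) (p : ℝ)
    (x : V) : ℝ :=
  expect G p (fun ω => ((cluster ω x).ncard : ℝ))

/-- The configuration `ω_A`, obtained from `ω` by closing all the edges that touch `A`. -/
def off {V : Type*} (ω : SimpleGraph V) (A : Set V) : SimpleGraph V :=
  ω.deleteEdges {e | ∃ a ∈ A, a ∈ e}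

/-- The intrinsic sphere `∂B_x(r; A)` off `A`: the vertices at distance exactly `r` from `x` in
the graph metric of `ω_A`.  The distance `edist` is `⊤` between vertices that are not connected. -/
def sphereOff {V : Type*} (ω : SimpleGraph V) (x : V) (r : ℕ) (A : Set V) : Set V :=
  {y | (off ω A).edist x y = (r : ℕ∞)}

/-- The graph is vertex-transitive. -/
def IsTransitive {V : Type*} (G : SimpleGraph V) : Prop :=
  ∀ x y : V, ∃ φ : G ≃g G, φ x = y

/-- The number of neighbours of a vertex. -/
noncomputable def deg {V : Type*} (G : SimpleGraph V) (x : V) : ℕ :=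
  (G.neighborSet x).ncard

/-- The law of the directed edge which the non-backtracking random walk started at `x` traverses
in its step number `t + 1`.  The first edge is uniform among the edges out of `x`; after `(u, v)`
the next edge `(v, w)` is uniform among the `deg v - 1` edges out of `v` with `w ≠ u`. -/
noncomputable def nbwEdgeLaw {V : Type*} [Fintype V] (G : SimpleGraph V) (x : V) :
    ℕ → V → V → ℝ
  | 0, u, v => open Classical in if u = x ∧ G.Adj u v then 1 / (deg G x : ℝ) else 0
  | t + 1, v, w =>
      open Classical in
      ∑ u, nbwEdgeLaw G x t u v *
        (if G.Adj v w ∧ w ≠ u then 1 / ((deg G v : ℝ) - 1) else 0)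

/-- The probability `𝐩ᵗ(x, y)` that the non-backtracking random walk started at `x` is at `y` at
time `t`, that is, after `t` steps. -/
noncomputable def nbwProb {V : Type*} [Fintype V] (G : SimpleGraph V) : ℕ → V → V → ℝ
  | 0, x, y => open Classical in if x = y then 1 else 0
  | t + 1, x, y => ∑ u, nbwEdgeLaw G x t u y

/-- `t₀` is the `ξ`-uniform mixing time of the non-backtracking random walk on `G`: the least `t`
with `max_{x, y} (𝐩ᵗ(x, y) + 𝐩ᵗ⁺¹(x, y)) / 2 ≤ (1 + ξ) / |V|` (in particular, such `t` exist). -/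
def IsUniformMixingTime {V : Type*} [Fintype V] (G : SimpleGraph V) (ξ : ℝ) (t₀ : ℕ) : Prop :=
  IsLeast {t : ℕ | ∀ x y : V,
    (nbwProb G t x y + nbwProb G (t + 1) x y) / 2 ≤ (1 + ξ) * (Fintype.card V : ℝ)⁻¹} t₀

/-- The sum over all vertices `u, v` and all times `t₁, t₂, t₃ ∈ [0, N]` with
`t₁ + t₂ + t₃ ≥ 3` of `𝐩^{t₁}(x, u) 𝐩^{t₂}(u, v) 𝐩^{t₃}(v, y)`. -/
noncomputable def nbwTriangle {V : Type*} [Fintype V] (G : SimpleGraph V) (N : ℕ)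
    (x y : V) : ℝ :=
  ∑ u, ∑ v, ∑ t₁ ∈ Finset.range (N + 1), ∑ t₂ ∈ Finset.range (N + 1),
    ∑ t₃ ∈ Finset.range (N + 1),
      if 3 ≤ t₁ + t₂ + t₃ then nbwProb G t₁ x u * nbwProb G t₂ u v * nbwProb G t₃ v y else 0

/-- `p` is the critical probability `p_c(lam)`: it lies in `[0, 1]` and satisfies
`E_p |C(o)| = lam * |V| ^ (1 / 3)`. -/
def IsCriticalProb {V : Type*} [Fintype V] (G : SimpleGraph V) (o : V) (lam p : ℝ) : Prop :=
  0 ≤ p ∧ p ≤ 1 ∧ expectedClusterSize G p o = lam * (Fintype.card V : ℝ) ^ (1 / 3 : ℝ)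

end Perc

/-! Write g(r) for the largest expected sphere size at radius r, over all base points and all sets
A; write χ for the expected cluster size, V for the number of vertices and N for the mixing time.

Gluing. Let x lie on the sphere of radius r and let x' be a neighbour of x whose cluster is disjoint
from that of 0. Opening the edge (x, x') makes it pivotal for the connection of 0 to every vertex y
of the glued cluster, and for a given y at most one edge is pivotal in this way at level r
(`PivotalAt.unique`). Summing over y and dividing by χ gives p m g(r) ≤ 1 + error
(`mul_sphereMass_le_one_add`), where the error accounts for the two clusters meeting at some vertex
a.

The error is a tree-graph sum (`prob_edist_and_reachable_le`): the geodesic from 0 to x branches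
towards a at a vertex z of level s. Exact distances are not monotone events, so this needs a van den
Berg-Kesten inequality with an additional decreasing event (`subsetProb_boxOn_le`). If r - s ≤ N,
the stretch from z to x is dominated by the non-backtracking walk, and the resulting loops are
controlled by the triangle condition (`sum_loopWeight_le`). If r - s > N, the last N steps are
already mixed and each level contributes O(g² χ² / V). As χ = V^(1/3) / 10, the sum over levels
stays small for r up to about V^(1/3) (`glueError_le`).

Bootstrap (`sphereMass_le_of_mixing`). One more level multiplies the mass by at most p m, which is
close to 1. So 6/5 at level r - 1 gives the a priori bound 5/4 at level r, and gluing improves it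
back to 6/5. Beyond V^(1/3), the pigeonhole principle gives an earlier level of mass at most 1/10,
and submultiplicativity (`sphereMass_add_le`) concludes. Submultiplicativity is the reason for
carrying the set A: after a ball is explored, the process continues off that ball. -/

namespace Perc

/-! ### Product measures on finite sets and a van den Berg-Kesten inequality. -/

section ProductMeasure

open Classical in
/-- The expectation of `f S` for a random subset `S` of `E` that contains each element of `E`
independently with probability `p`. -/
noncomputable def subsetExpect {ι : Type*} (E : Finset ι) (p : ℝ) (f : Finset ι → ℝ) : ℝ :=
  ∑ S ∈ E.powerset, p ^ S.card * (1 - p) ^ (E \ S).card * f S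

open Classical in
/-- The probability of the event `X` under the product measure on subsets of `E`. -/
noncomputable def subsetProb {ι : Type*} (E : Finset ι) (p : ℝ) (X : Finset ι → Prop) : ℝ :=
  subsetExpect E p (fun S => if X S then 1 else 0)

variable {ι : Type*} {E : Finset ι} {p : ℝ}

lemma subsetExpect_empty (f : Finset ι → ℝ) : subsetExpect ∅ p f = f ∅ := by
  simp [subsetExpect]

-- Conditioning on whether `e` is present; this recursion drives the inductions on `E`.
open Classical in
lemma subsetExpect_insert {e : ι} (he : e ∉ E) (f : Finset ι → ℝ) :
    subsetExpect (insert e E) p f =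
      (1 - p) * subsetExpect E p f + p * subsetExpect E p (fun S => f (insert e S)) := by
  unfold subsetExpect
  rw [Finset.sum_powerset_insert he, Finset.mul_sum, Finset.mul_sum]
  congr 1
  · refine Finset.sum_congr rfl fun S hS => ?_
    have hS' : e ∉ S := fun h => he (Finset.mem_powerset.1 hS h)
    rw [Finset.insert_sdiff_of_notMem _ hS', Finset.card_insert_of_notMem (by simp [he])]
    ring
  · refine Finset.sum_congr rfl fun S hS => ?_
    have hS' : e ∉ S := fun h => he (Finset.mem_powerset.1 hS h)
    have : insert e E \ insert e S = E \ S := by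
      ext a; simp only [Finset.mem_sdiff, Finset.mem_insert]
      constructor
      · rintro ⟨h | h, h'⟩ <;> simp_all
      · rintro ⟨h, h'⟩
        refine ⟨Or.inr h, ?_⟩
        rintro (rfl | h'') <;> contradiction
    rw [this, Finset.card_insert_of_notMem hS']
    ring

lemma subsetExpect_congr {f g : Finset ι → ℝ} (h : ∀ S ⊆ E, f S = g S) :
    subsetExpect E p f = subsetExpect E p g :=
  Finset.sum_congr rfl fun S hS => by rw [h S (Finset.mem_powerset.1 hS)]

lemma subsetExpect_mono (h0 : 0 ≤ p) (h1 : p ≤ 1) {f g : Finset ι → ℝ}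
    (h : ∀ S ⊆ E, f S ≤ g S) : subsetExpect E p f ≤ subsetExpect E p g :=
  Finset.sum_le_sum fun S hS =>
    mul_le_mul_of_nonneg_left (h S (Finset.mem_powerset.1 hS))
      (mul_nonneg (pow_nonneg h0 _) (pow_nonneg (by linarith) _))

lemma subsetExpect_add (f g : Finset ι → ℝ) :
    subsetExpect E p (fun S => f S + g S) = subsetExpect E p f + subsetExpect E p g := by
  simp [subsetExpect, mul_add, Finset.sum_add_distrib]

lemma subsetExpect_sum {κ : Type*} (s : Finset κ) (f : κ → Finset ι → ℝ) :
    subsetExpect E p (fun S => ∑ i ∈ s, f i S) = ∑ i ∈ s, subsetExpect E p (f i) := by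
  simp only [subsetExpect, Finset.mul_sum]
  exact Finset.sum_comm

lemma subsetExpect_const (c : ℝ) : subsetExpect E p (fun _ => c) = c := by
  classical
  induction E using Finset.induction_on with
  | empty => exact subsetExpect_empty _
  | insert e E he ih => rw [subsetExpect_insert he, ih]; ring

lemma subsetProb_nonneg (h0 : 0 ≤ p) (h1 : p ≤ 1) (X : Finset ι → Prop) :
    0 ≤ subsetProb E p X := by
  have := subsetExpect_mono (E := E) h0 h1 (f := fun _ => 0)
    (g := fun S => open Classical in if X S then 1 else 0)
    (fun S _ => by positivity)
  rwa [subsetExpect_const] at this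

lemma subsetProb_mono (h0 : 0 ≤ p) (h1 : p ≤ 1) {X Y : Finset ι → Prop}
    (h : ∀ S ⊆ E, X S → Y S) : subsetProb E p X ≤ subsetProb E p Y := by
  refine subsetExpect_mono h0 h1 fun S hS => ?_
  have := h S hS
  by_cases hX : X S
  · simp [hX, this hX]
  · simp only [hX, if_false]; positivity

lemma subsetProb_insert [DecidableEq ι] {e : ι} (he : e ∉ E) (X : Finset ι → Prop) :
    subsetProb (insert e E) p X =
      (1 - p) * subsetProb E p X + p * subsetProb E p (fun S => X (insert e S)) := by
  have := subsetExpect_insert (p := p) he (fun S => open Classical in if X S then (1 : ℝ) else 0)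
  unfold subsetProb
  convert this

/-- Two functions of disjoint sets of coordinates are independent. -/
lemma subsetExpect_mul_of_indep (F : Set ι) {f g : Finset ι → ℝ}
    (hf : ∀ S S' : Finset ι, (∀ e ∈ F, e ∈ S ↔ e ∈ S') → f S = f S')
    (hg : ∀ S S' : Finset ι, (∀ e ∉ F, e ∈ S ↔ e ∈ S') → g S = g S') :
    subsetExpect E p (fun S => f S * g S) = subsetExpect E p f * subsetExpect E p g := by
  classical
  induction E using Finset.induction_on generalizing f g with
  | empty => simp [subsetExpect_empty]
  | insert e E he ih =>
    rw [subsetExpect_insert he, subsetExpect_insert he, subsetExpect_insert he, ih hf hg]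
    by_cases heF : e ∈ F
    · have hg' : (fun S => g (insert e S)) = g := by
        funext S
        refine hg _ _ fun a ha => ?_
        have : a ≠ e := fun h => ha (h ▸ heF)
        simp [this]
      have hf' : ∀ S S' : Finset ι, (∀ a ∈ F, a ∈ S ↔ a ∈ S') →
          f (insert e S) = f (insert e S') := fun S S' h =>
        hf _ _ fun a ha => by simp [h a ha]
      have := ih hf' hg
      have h2 : (fun S => f (insert e S) * g (insert e S)) = fun S => f (insert e S) * g S := by
        funext S; rw [congrFun hg' S]
      rw [h2, this, hg']; ring
    · have hf' : (fun S => f (insert e S)) = f := by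
        funext S
        refine hf _ _ fun a ha => ?_
        have : a ≠ e := fun h => heF (h ▸ ha)
        simp [this]
      have hg' : ∀ S S' : Finset ι, (∀ a ∉ F, a ∈ S ↔ a ∈ S') →
          g (insert e S) = g (insert e S') := fun S S' h =>
        hg _ _ fun a ha => by simp [h a ha]
      have := ih hf hg'
      have h2 : (fun S => f (insert e S) * g (insert e S)) = fun S => f S * g (insert e S) := by
        funext S; rw [congrFun hf' S]
      rw [h2, this, hf']; ring

open Classical in
/-- Opening the coordinate `e` costs a factor `p / (1 - p)`. -/
lemma subsetExpect_flip {e : ι} (he : e ∈ E) (f : Finset ι → ℝ) :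
    (1 - p) * subsetExpect E p (fun S => if e ∈ S then f (S.erase e) else 0) =
      p * subsetExpect E p (fun S => if e ∈ S then 0 else f S) := by
  obtain ⟨E', he', rfl⟩ : ∃ E', e ∉ E' ∧ E = insert e E' :=
    ⟨E.erase e, Finset.notMem_erase _ _, (Finset.insert_erase he).symm⟩
  rw [subsetExpect_insert he', subsetExpect_insert he']
  have h1 : subsetExpect E' p (fun S => if e ∈ S then f (S.erase e) else 0) = 0 := by
    rw [subsetExpect_congr (g := fun _ => 0), subsetExpect_const]
    intro S hS; rw [if_neg fun h => he' (hS h)]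
  have h2 : subsetExpect E' p (fun S => if e ∈ insert e S then f ((insert e S).erase e) else 0) =
      subsetExpect E' p f := by
    refine subsetExpect_congr fun S hS => ?_
    rw [if_pos (Finset.mem_insert_self _ _), Finset.erase_insert fun h => he' (hS h)]
  have h3 : subsetExpect E' p (fun S => if e ∈ S then 0 else f S) = subsetExpect E' p f := by
    refine subsetExpect_congr fun S hS => ?_
    rw [if_neg fun h => he' (hS h)]
  have h4 : subsetExpect E' p (fun S => if e ∈ insert e S then 0 else f (insert e S)) = 0 := by
    rw [subsetExpect_congr (g := fun _ => 0), subsetExpect_const]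
    intro S hS; simp
  rw [h1, h2, h3, h4]; ring

/-- The disjoint occurrence of two events. -/
def BoxOn (I B : Finset ι → Prop) (S : Finset ι) : Prop :=
  ∃ S₁ S₂, S₁ ⊆ S ∧ S₂ ⊆ S ∧ Disjoint S₁ S₂ ∧ I S₁ ∧ B S₂

lemma BoxOn.imp {I B I' B' : Finset ι → Prop} {S : Finset ι} (h : BoxOn I B S)
    (hI : ∀ S, I S → I' S) (hB : ∀ S, B S → B' S) : BoxOn I' B' S := by
  obtain ⟨S₁, S₂, h1, h2, h3, h4, h5⟩ := h
  exact ⟨S₁, S₂, h1, h2, h3, hI _ h4, hB _ h5⟩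

-- The coordinate `e` lies in at most one of the two disjoint witnesses, so only one of the events
-- needs it.
open Classical in
lemma BoxOn.of_insert {I B : Finset ι → Prop}
    (hB : ∀ S S', S ⊆ S' → B S → B S') {e : ι} {S : Finset ι}
    (h : BoxOn I B (insert e S)) :
    BoxOn (fun S => I (insert e S)) B S ∨ BoxOn I (fun S => B (insert e S)) S := by
  obtain ⟨S₁, S₂, h1, h2, h3, h4, h5⟩ := h
  by_cases he : e ∈ S₁
  · have he2 : e ∉ S₂ := Finset.disjoint_left.1 h3 he
    refine Or.inl ⟨S₁.erase e, S₂, Finset.subset_insert_iff.1 h1, ?_,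
      Finset.disjoint_of_subset_left (Finset.erase_subset _ _) h3, ?_, h5⟩
    · exact (Finset.subset_insert_iff_of_notMem he2).1 h2
    · simpa only [Finset.insert_erase he] using h4
  · refine Or.inr ⟨S₁, S₂.erase e, (Finset.subset_insert_iff_of_notMem he).1 h1,
      Finset.subset_insert_iff.1 h2,
      Finset.disjoint_of_subset_right (Finset.erase_subset _ _) h3, h4, ?_⟩
    exact hB _ _ (fun a ha => by by_cases hae : a = e <;> simp [hae, ha]) h5

/-- A van den Berg-Kesten inequality: an intersection of an increasing and a decreasing event,
and an increasing event that occurs disjointly from the increasing one. -/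
theorem subsetProb_boxOn_le (h0 : 0 ≤ p) (h2 : p ≤ 1 / 2) {I B D : Finset ι → Prop}
    (hI : ∀ S S', S ⊆ S' → I S → I S') (hB : ∀ S S', S ⊆ S' → B S → B S')
    (hD : ∀ S S', S ⊆ S' → D S' → D S) :
    subsetProb E p (fun S => D S ∧ BoxOn I B S) ≤
      subsetProb E p (fun S => D S ∧ I S) * subsetProb E p B := by
  classical
  have h1 : p ≤ 1 := by linarith
  induction E using Finset.induction_on generalizing I B D with
  | empty =>
    simp only [subsetProb, subsetExpect_empty]
    by_cases h : D ∅ ∧ BoxOn I B ∅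
    · obtain ⟨hD0, S₁, S₂, a1, a2, -, a4, a5⟩ := h
      have e1 := hI _ _ a1 a4
      have e2 := hB _ _ a2 a5
      split_ifs <;> simp_all
    · rw [if_neg h]; positivity
  | insert e E he ih =>
    have ins : ∀ S : Finset ι, S ⊆ insert e S := fun S => Finset.subset_insert _ _
    have insm : ∀ S S' : Finset ι, S ⊆ S' → insert e S ⊆ insert e S' :=
      fun S S' h => Finset.insert_subset_insert _ h
    rw [subsetProb_insert he, subsetProb_insert he, subsetProb_insert he]
    set i₀ := subsetProb E p (fun S => D S ∧ I S)
    set i₁ := subsetProb E p (fun S => D (insert e S) ∧ I (insert e S))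
    set b₀ := subsetProb E p B
    set b₁ := subsetProb E p (fun S => B (insert e S))
    set z₀ := subsetProb E p (fun S => D S ∧ BoxOn I B S)
    set z₁ := subsetProb E p (fun S => D (insert e S) ∧ BoxOn I B (insert e S))
    have hI1 : ∀ S S', S ⊆ S' → I (insert e S) → I (insert e S') :=
      fun S S' h => hI _ _ (insm _ _ h)
    have hB1 : ∀ S S', S ⊆ S' → B (insert e S) → B (insert e S') :=
      fun S S' h => hB _ _ (insm _ _ h)
    have hD1 : ∀ S S', S ⊆ S' → D (insert e S') → D (insert e S) :=
      fun S S' h => hD _ _ (insm _ _ h)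
    have k00 : z₀ ≤ i₀ * b₀ := ih hI hB hD
    have k10 := ih hI1 hB hD1
    have k01 := ih hI hB1 hD
    have k11 := ih hI1 hB1 hD1
    have hb : b₀ ≤ b₁ := subsetProb_mono h0 h1 fun S _ h => hB _ _ (ins S) h
    have hb0 : 0 ≤ b₀ := subsetProb_nonneg h0 h1 _
    have hi0 : 0 ≤ i₀ := subsetProb_nonneg h0 h1 _
    have hi1 : 0 ≤ i₁ := subsetProb_nonneg h0 h1 _
    have u1 : z₁ ≤ i₁ * b₁ := by
      refine le_trans (subsetProb_mono h0 h1 fun S _ h => ⟨h.1, ?_⟩) k11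
      rcases BoxOn.of_insert hB h.2 with h' | h'
      · exact h'.imp (fun _ => id) fun S => hB _ _ (ins S)
      · exact h'.imp (fun S => hI _ _ (ins S)) fun _ => id
    -- Pointwise in `S`: the occurrences at `S` and at `insert e S` are charged to two events, one
    -- that lends `e` to `I` and one that lends it to `B`.
    have u2 : z₁ + z₀ ≤ i₁ * b₀ + i₀ * b₁ := by
      refine le_trans ?_ (add_le_add k10 k01)
      simp only [z₁, z₀, subsetProb, ← subsetExpect_add]
      refine subsetExpect_mono h0 h1 fun S _ => ?_
      by_cases hz : D S ∧ BoxOn I B S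
      · have q1 : D S ∧ BoxOn I (fun S => B (insert e S)) S :=
          ⟨hz.1, hz.2.imp (fun _ => id) fun S => hB _ _ (ins S)⟩
        rw [if_pos hz, if_pos q1]
        by_cases hz' : D (insert e S) ∧ BoxOn I B (insert e S)
        · have q2 : D (insert e S) ∧ BoxOn (fun S => I (insert e S)) B S :=
            ⟨hz'.1, hz.2.imp (fun S => hI _ _ (ins S)) fun _ => id⟩
          rw [if_pos hz', if_pos q2]
        · rw [if_neg hz', zero_add]
          exact le_add_of_nonneg_left (by positivity)
      · rw [if_neg hz, add_zero]
        by_cases hz' : D (insert e S) ∧ BoxOn I B (insert e S)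
        · rw [if_pos hz']
          rcases BoxOn.of_insert hB hz'.2 with h' | h'
          · rw [if_pos ⟨hz'.1, h'⟩]
            exact le_add_of_nonneg_right (by positivity)
          · have q1 : D S ∧ BoxOn I (fun S => B (insert e S)) S := ⟨hD _ _ (ins S) hz'.1, h'⟩
            rw [if_pos q1]
            exact le_add_of_nonneg_left (by positivity)
        · rw [if_neg hz']; positivity
    -- The event `D ∧ I` is not monotone, so `i₀` and `i₁` come in no fixed order. If `i₀ ≤ i₁`,
    -- split the left side as (1 - 2p) z₀ + p (z₀ + z₁), which is where p ≤ 1/2 enters; otherwise z₀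
    -- and z₁ are bounded separately.
    rcases le_total i₀ i₁ with hc | hc
    · have e1 : (1 - p) * z₀ + p * z₁ ≤ (1 - 2 * p) * (i₀ * b₀) + p * (i₁ * b₀ + i₀ * b₁) := by
        have := mul_le_mul_of_nonneg_left u2 h0
        have := mul_le_mul_of_nonneg_left k00 (show 0 ≤ 1 - 2 * p by linarith)
        linarith
      have e2 : 0 ≤ p ^ 2 * ((i₁ - i₀) * (b₁ - b₀)) :=
        mul_nonneg (sq_nonneg _) (mul_nonneg (by linarith) (by linarith))
      linarith
    · have e1 : (1 - p) * z₀ + p * z₁ ≤ (1 - p) * (i₀ * b₀) + p * (i₁ * b₁) :=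
        add_le_add (mul_le_mul_of_nonneg_left k00 (by linarith))
          (mul_le_mul_of_nonneg_left u1 h0)
      have e2 : 0 ≤ p * (1 - p) * ((i₀ - i₁) * (b₁ - b₀)) :=
        mul_nonneg (mul_nonneg h0 (by linarith)) (mul_nonneg (by linarith) (by linarith))
      linarith

end ProductMeasure

/-! ### The random graph: union bound, independence, disjoint occurrence, symmetry. -/

section Percolation

variable {V : Type*} [Fintype V] {G : SimpleGraph V} {p : ℝ}

/-- The probability of the event `X` of the random graph `G_p`. -/
noncomputable def prob (G : SimpleGraph V) (p : ℝ) (X : SimpleGraph V → Prop) : ℝ :=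
  expect G p (fun ω => open Classical in if X ω then 1 else 0)

open Classical in
lemma expect_eq_subsetExpect (X : SimpleGraph V → ℝ) :
    expect G p X =
      subsetExpect G.edgeFinset p (fun S => X (SimpleGraph.fromEdgeSet (S : Set (Sym2 V)))) := by
  unfold expect subsetExpect
  congr!

open Classical in
lemma prob_eq_subsetProb (X : SimpleGraph V → Prop) :
    prob G p X =
      subsetProb G.edgeFinset p (fun S => X (SimpleGraph.fromEdgeSet (S : Set (Sym2 V)))) :=
  expect_eq_subsetExpect _

open Classical in
lemma fromEdgeSet_le_of_subset {S : Finset (Sym2 V)} (hS : S ⊆ G.edgeFinset) :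
    SimpleGraph.fromEdgeSet (S : Set (Sym2 V)) ≤ G := by
  intro u v h
  rw [SimpleGraph.fromEdgeSet_adj] at h
  have := hS (Finset.mem_coe.1 h.1)
  simpa using this

lemma expect_mono (h0 : 0 ≤ p) (h1 : p ≤ 1) {X Y : SimpleGraph V → ℝ}
    (h : ∀ ω ≤ G, X ω ≤ Y ω) : expect G p X ≤ expect G p Y := by
  classical
  rw [expect_eq_subsetExpect, expect_eq_subsetExpect]
  exact subsetExpect_mono h0 h1 fun S hS => h _ (fromEdgeSet_le_of_subset hS)

lemma expect_congr {X Y : SimpleGraph V → ℝ} (h : ∀ ω ≤ G, X ω = Y ω) :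
    expect G p X = expect G p Y := by
  classical
  rw [expect_eq_subsetExpect, expect_eq_subsetExpect]
  exact subsetExpect_congr fun S hS => h _ (fromEdgeSet_le_of_subset hS)

lemma expect_sum {κ : Type*} (s : Finset κ) (X : κ → SimpleGraph V → ℝ) :
    expect G p (fun ω => ∑ i ∈ s, X i ω) = ∑ i ∈ s, expect G p (X i) := by
  classical
  simp only [expect_eq_subsetExpect]
  exact subsetExpect_sum s fun i (S : Finset (Sym2 V)) =>
    X i (SimpleGraph.fromEdgeSet (S : Set (Sym2 V)))

lemma expect_const (c : ℝ) : expect G p (fun _ => c) = c := by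
  classical
  rw [expect_eq_subsetExpect, subsetExpect_const]

lemma expect_nonneg (h0 : 0 ≤ p) (h1 : p ≤ 1) {X : SimpleGraph V → ℝ} (h : ∀ ω, 0 ≤ X ω) :
    0 ≤ expect G p X := by
  have := expect_mono (G := G) h0 h1 (X := fun _ => 0) fun ω _ => h ω
  rwa [expect_const] at this

lemma prob_nonneg (h0 : 0 ≤ p) (h1 : p ≤ 1) (X : SimpleGraph V → Prop) : 0 ≤ prob G p X :=
  expect_nonneg h0 h1 fun ω => by positivity

lemma prob_mono (h0 : 0 ≤ p) (h1 : p ≤ 1) {X Y : SimpleGraph V → Prop}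
    (h : ∀ ω ≤ G, X ω → Y ω) : prob G p X ≤ prob G p Y := by
  refine expect_mono h0 h1 fun ω hω => ?_
  have := h ω hω
  by_cases hX : X ω
  · simp [hX, this hX]
  · simp only [hX, if_false]; positivity

lemma prob_congr {X Y : SimpleGraph V → Prop} (h : ∀ ω ≤ G, X ω ↔ Y ω) :
    prob G p X = prob G p Y :=
  expect_congr fun ω hω => by rw [propext (h ω hω)]

lemma prob_true : prob G p (fun _ => True) = 1 := by
  simp only [prob, if_true]; exact expect_const 1

lemma prob_le_one (h0 : 0 ≤ p) (h1 : p ≤ 1) (X : SimpleGraph V → Prop) : prob G p X ≤ 1 :=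
  (prob_mono h0 h1 (Y := fun _ => True) fun _ _ _ => trivial).trans_eq prob_true

lemma prob_false {X : SimpleGraph V → Prop} (h : ∀ ω ≤ G, ¬ X ω) : prob G p X = 0 := by
  rw [prob, expect_congr (Y := fun _ => 0), expect_const]
  intro ω hω
  rw [if_neg (h ω hω)]

/-- The union bound. -/
lemma prob_le_sum (h0 : 0 ≤ p) (h1 : p ≤ 1) {κ : Type*} (s : Finset κ)
    {X : SimpleGraph V → Prop} {Y : κ → SimpleGraph V → Prop}
    (h : ∀ ω ≤ G, X ω → ∃ i ∈ s, Y i ω) : prob G p X ≤ ∑ i ∈ s, prob G p (Y i) := by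
  simp only [prob]
  rw [← expect_sum]
  refine expect_mono h0 h1 fun ω hω => ?_
  by_cases hX : X ω
  · obtain ⟨i, hi, hY⟩ := h ω hω hX
    rw [if_pos hX]
    refine le_trans ?_ (Finset.single_le_sum (f := fun i => open Classical in
      if Y i ω then (1 : ℝ) else 0) (fun _ _ => by positivity) hi)
    simp [hY]
  · rw [if_neg hX]; exact Finset.sum_nonneg fun _ _ => by positivity

/-- The law of total probability. -/
lemma prob_eq_sum_fiber {κ : Type*} [Fintype κ] (X : SimpleGraph V → Prop)
    (N : SimpleGraph V → κ) : prob G p X = ∑ K, prob G p (fun ω => N ω = K ∧ X ω) := by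
  classical
  simp only [prob]
  rw [← expect_sum]
  refine expect_congr fun ω _ => ?_
  rw [Finset.sum_eq_single (N ω)]
  · simp
  · intro b _ hb; rw [if_neg]; exact fun h => hb h.1.symm
  · simp

lemma prob_eq_add (X Y : SimpleGraph V → Prop) :
    prob G p X = prob G p (fun ω => X ω ∧ Y ω) + prob G p (fun ω => X ω ∧ ¬ Y ω) := by
  classical
  rw [prob_eq_sum_fiber X fun ω => decide (Y ω)]
  simp [and_comm]

lemma expect_ncard (X : V → SimpleGraph V → Prop) :
    expect G p (fun ω => (({y | X y ω} : Set V).ncard : ℝ)) = ∑ y, prob G p (X y) := by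
  classical
  simp only [prob]
  rw [← expect_sum]
  refine expect_congr fun ω _ => ?_
  rw [Set.ncard_eq_toFinset_card']
  simp

/-- Disjoint occurrence of two events of a random graph. -/
def Box (I B : SimpleGraph V → Prop) (ω : SimpleGraph V) : Prop :=
  ∃ ω₁ ω₂, ω₁ ≤ ω ∧ ω₂ ≤ ω ∧ Disjoint ω₁ ω₂ ∧ I ω₁ ∧ B ω₂

omit [Fintype V] in
lemma Box.monotone (I B : SimpleGraph V → Prop) : Monotone (Box I B) := by
  rintro ω ω' h ⟨ω₁, ω₂, h1, h2, h3⟩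
  exact ⟨ω₁, ω₂, h1.trans h, h2.trans h, h3⟩

/-- Witnesses of `Box` are subgraphs and those of `BoxOn` are edge sets; monotonicity makes one
inclusion between them sufficient. In the application `D` carries lower bounds on distances and `I`
upper bounds, so that together they fix distances exactly. -/
theorem prob_and_box_le (h0 : 0 ≤ p) (h2 : p ≤ 1 / 2) {D I B : SimpleGraph V → Prop}
    (hD : Antitone D) (hI : Monotone I) (hB : Monotone B) :
    prob G p (fun ω => D ω ∧ Box I B ω) ≤ prob G p (fun ω => D ω ∧ I ω) * prob G p B := by
  classical
  have hgr : ∀ S S' : Finset (Sym2 V), S ⊆ S' →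
      SimpleGraph.fromEdgeSet (S : Set (Sym2 V)) ≤ SimpleGraph.fromEdgeSet (S' : Set (Sym2 V)) :=
    fun S S' h => SimpleGraph.fromEdgeSet_mono (by exact_mod_cast h)
  rw [prob_eq_subsetProb, prob_eq_subsetProb, prob_eq_subsetProb]
  refine le_trans (subsetProb_mono h0 (by linarith) fun S hS h => ?_)
    (subsetProb_boxOn_le (D := fun S => D (SimpleGraph.fromEdgeSet (S : Set (Sym2 V))))
      (I := fun S => I (SimpleGraph.fromEdgeSet (S : Set (Sym2 V))))
      (B := fun S => B (SimpleGraph.fromEdgeSet (S : Set (Sym2 V)))) h0 h2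
      (fun S S' h => hI (hgr S S' h)) (fun S S' h => hB (hgr S S' h))
      (fun S S' h => hD (hgr S S' h)))
  refine ⟨h.1, ?_⟩
  obtain ⟨ω₁, ω₂, h1, h2, h3, h4, h5⟩ := h.2
  have key : ∀ ω : SimpleGraph V, ω ≤ SimpleGraph.fromEdgeSet (S : Set (Sym2 V)) →
      ω ≤ SimpleGraph.fromEdgeSet ((S.filter (· ∈ ω.edgeSet) : Finset (Sym2 V)) : Set (Sym2 V)) := by
    intro ω hω u v huv
    have := hω huv
    rw [SimpleGraph.fromEdgeSet_adj] at this ⊢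
    refine ⟨?_, this.2⟩
    simp only [Finset.coe_filter, Set.mem_ofPred_eq, SimpleGraph.mem_edgeSet]
    exact ⟨this.1, huv⟩
  refine ⟨S.filter (· ∈ ω₁.edgeSet), S.filter (· ∈ ω₂.edgeSet), Finset.filter_subset _ _,
    Finset.filter_subset _ _, ?_, hI (key ω₁ h1) h4, hB (key ω₂ h2) h5⟩
  rw [Finset.disjoint_left]
  intro e he he'
  exact Set.disjoint_left.1 (SimpleGraph.disjoint_edgeSet.2 h3) (Finset.mem_filter.1 he).2
    (Finset.mem_filter.1 he').2

theorem prob_box_le (h0 : 0 ≤ p) (h2 : p ≤ 1 / 2) {I B : SimpleGraph V → Prop}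
    (hI : Monotone I) (hB : Monotone B) :
    prob G p (Box I B) ≤ prob G p I * prob G p B := by
  simpa using prob_and_box_le (G := G) h0 h2 (D := fun _ => True) (fun _ _ _ => id) hI hB

/-- An event of the edges that touch `K` is independent of an event of the other edges. -/
theorem prob_and_of_indep (K : Set V) {X Y : SimpleGraph V → Prop}
    (hX : ∀ ω ω' : SimpleGraph V, (∀ u ∈ K, ∀ v, ω.Adj u v ↔ ω'.Adj u v) → X ω → X ω')
    (hY : ∀ ω ω' : SimpleGraph V, (∀ u ∉ K, ∀ v ∉ K, ω.Adj u v ↔ ω'.Adj u v) → Y ω → Y ω') :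
    prob G p (fun ω => X ω ∧ Y ω) = prob G p X * prob G p Y := by
  classical
  simp only [prob, expect_eq_subsetExpect]
  rw [← subsetExpect_mul_of_indep {e | ∃ k ∈ K, k ∈ e}]
  · congr 1; funext S
    split_ifs <;> simp_all
  · intro S S' h
    have : X (SimpleGraph.fromEdgeSet (S : Set (Sym2 V))) ↔
        X (SimpleGraph.fromEdgeSet (S' : Set (Sym2 V))) := by
      have key : ∀ u ∈ K, ∀ v, (SimpleGraph.fromEdgeSet (S : Set (Sym2 V))).Adj u v ↔
          (SimpleGraph.fromEdgeSet (S' : Set (Sym2 V))).Adj u v := by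
        intro u hu v
        have := h s(u, v) ⟨u, hu, by simp⟩
        simp [SimpleGraph.fromEdgeSet_adj, this]
      exact ⟨hX _ _ key, hX _ _ fun u hu v => (key u hu v).symm⟩
    simp only [this]
  · intro S S' h
    have : Y (SimpleGraph.fromEdgeSet (S : Set (Sym2 V))) ↔
        Y (SimpleGraph.fromEdgeSet (S' : Set (Sym2 V))) := by
      have key : ∀ u ∉ K, ∀ v ∉ K, (SimpleGraph.fromEdgeSet (S : Set (Sym2 V))).Adj u v ↔
          (SimpleGraph.fromEdgeSet (S' : Set (Sym2 V))).Adj u v := by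
        intro u hu v hv
        have := h s(u, v) (by
          rintro ⟨k, hk, hk'⟩
          rcases Sym2.mem_iff.1 hk' with rfl | rfl <;> contradiction)
        simp [SimpleGraph.fromEdgeSet_adj, this]
      exact ⟨hY _ _ key, hY _ _ fun u hu v hv => (key u hu v hv).symm⟩
    simp only [this]

/-- Opening a closed edge: this converts "two separate clusters" into "a pivotal open edge". -/
lemma prob_open_edge_eq {x y : V} (hxy : G.Adj x y) (X : SimpleGraph V → Prop) :
    (1 - p) * prob G p (fun ω => ω.Adj x y ∧ X (ω.deleteEdges {s(x, y)})) =
      p * prob G p (fun ω => ¬ ω.Adj x y ∧ X ω) := by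
  classical
  have h := subsetExpect_flip (p := p) (E := G.edgeFinset) (e := s(x, y)) (by simpa using hxy)
    (fun S => if X (SimpleGraph.fromEdgeSet (S : Set (Sym2 V))) then 1 else 0)
  have hadj : ∀ S : Finset (Sym2 V), (SimpleGraph.fromEdgeSet (S : Set (Sym2 V))).Adj x y ↔
      s(x, y) ∈ S := by
    intro S; simp [hxy.ne]
  have hdel : ∀ S : Finset (Sym2 V),
      (SimpleGraph.fromEdgeSet (S : Set (Sym2 V))).deleteEdges {s(x, y)} =
        SimpleGraph.fromEdgeSet ((S.erase s(x, y) : Finset (Sym2 V)) : Set (Sym2 V)) := by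
    intro S
    ext u v
    simp only [SimpleGraph.deleteEdges_adj, SimpleGraph.fromEdgeSet_adj, Set.mem_singleton_iff,
      Finset.coe_erase, Set.mem_sdiff]
    tauto
  rw [prob_eq_subsetProb, prob_eq_subsetProb, subsetProb, subsetProb]
  convert h using 4 with S S
  · simp only [hadj, hdel]
    split_ifs <;> simp_all
  · simp only [hadj]
    split_ifs <;> simp_all

open Classical in
lemma prob_adj_le (h0 : 0 ≤ p) (x y : V) :
    prob G p (fun ω => ω.Adj x y) ≤ if G.Adj x y then p else 0 := by
  classical
  split_ifs with h
  · have := prob_open_edge_eq (p := p) h fun _ => True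
    simp only [and_true] at this
    have h2 := prob_eq_add (G := G) (p := p) (fun _ => True) fun ω => ω.Adj x y
    simp only [true_and, prob_true] at h2
    nlinarith
  · exact (prob_false fun ω hω h' => h (hω h')).le

/-- An automorphism permutes the edge sets and preserves their weights. -/
lemma expect_comap (φ : G ≃g G) (X : SimpleGraph V → ℝ) :
    expect G p (fun ω => X (ω.comap φ)) = expect G p X := by
  classical
  let ψ : Sym2 V ≃ Sym2 V := ⟨Sym2.map φ.symm, Sym2.map φ,
    fun e => by induction e with | _ u v => simp, fun e => by induction e with | _ u v => simp⟩
  have hmem : ∀ (S : Finset (Sym2 V)) (e : Sym2 V), e ∈ ψ.finsetCongr S ↔ e.map φ ∈ S := by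
    intro S e
    simp only [Equiv.finsetCongr_apply, Finset.mem_map_equiv]
    rfl
  have hE : ψ.finsetCongr G.edgeFinset = G.edgeFinset := by
    ext e
    rw [hmem]
    induction e with
    | _ u v => simp [SimpleGraph.Iso.map_adj_iff]
  rw [expect_eq_subsetExpect, expect_eq_subsetExpect, subsetExpect, subsetExpect]
  refine Finset.sum_equiv ψ.finsetCongr ?_ ?_
  · intro S
    rw [Finset.mem_powerset, Finset.mem_powerset]
    conv_rhs => rw [← hE]
    simp
  · intro S hS
    have hsd : G.edgeFinset \ ψ.finsetCongr S = ψ.finsetCongr (G.edgeFinset \ S) := by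
      conv_lhs => rw [← hE]
      ext e; simp
    congr 1
    · congr 1
      · simp
      · congr 1
        have := congrArg Finset.card hsd
        rw [Equiv.finsetCongr_apply, Equiv.finsetCongr_apply, Finset.card_map] at this
        convert this.symm
        exact Equiv.finsetCongr_apply _ _
    · congr 1
      ext u v
      have := hmem S s(u, v)
      rw [SimpleGraph.comap_adj, SimpleGraph.fromEdgeSet_adj, SimpleGraph.fromEdgeSet_adj,
        Finset.mem_coe, Finset.mem_coe, this]
      simp

end Percolation

/-! ### Exploring balls, and submultiplicativity of sphere masses. -/

section Exploration

variable {V : Type*}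

lemma off_adj {ω : SimpleGraph V} {A : Set V} {u v : V} :
    (off ω A).Adj u v ↔ ω.Adj u v ∧ u ∉ A ∧ v ∉ A := by
  simp only [off, SimpleGraph.deleteEdges_adj, Set.mem_ofPred_eq, Sym2.mem_iff, not_exists, not_and]
  constructor
  · rintro ⟨h, h'⟩
    exact ⟨h, fun hu => h' u hu (Or.inl rfl), fun hv => h' v hv (Or.inr rfl)⟩
  · rintro ⟨h, hu, hv⟩
    refine ⟨h, fun a ha => ?_⟩
    rintro (rfl | rfl) <;> contradiction

lemma off_le (ω : SimpleGraph V) (A : Set V) : off ω A ≤ ω := fun _ _ h => (off_adj.1 h).1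

lemma off_mono {ω ω' : SimpleGraph V} (h : ω ≤ ω') (A : Set V) : off ω A ≤ off ω' A :=
  fun _ _ huv => off_adj.2 ⟨h (off_adj.1 huv).1, (off_adj.1 huv).2⟩

lemma off_anti (ω : SimpleGraph V) {A A' : Set V} (h : A ⊆ A') : off ω A' ≤ off ω A :=
  fun _ _ huv => off_adj.2 ⟨(off_adj.1 huv).1, fun hA => (off_adj.1 huv).2.1 (h hA),
    fun hA => (off_adj.1 huv).2.2 (h hA)⟩

/-- Exploring the graph `H'` from `x` up to distance `s` only uses edges that touch the open ball
of radius `s`. -/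
lemma edist_le_edist_of_agree {H H' : SimpleGraph V} {K : Set V} {s : ℕ∞} {x : V}
    (hK : ∀ v, H.edist x v < s → v ∈ K) (hag : ∀ u ∈ K, ∀ v, H'.Adj u v → H.Adj u v) {v : V}
    (hv : H'.edist x v ≤ s) : H.edist x v ≤ H'.edist x v := by
  -- The walk runs towards the centre `b`, so the induction peels off the edge furthest from it.
  have key : ∀ {a b : V} (q : H'.Walk a b), (q.length : ℕ∞) ≤ s →
      (∀ v, H.edist b v < s → v ∈ K) → H.edist b a ≤ q.length := by
    intro a b q
    induction q with
    | nil => intro _ _; simp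
    | @cons a c b h q ih =>
      intro hq hb
      rw [SimpleGraph.Walk.length_cons] at hq ⊢
      push_cast at hq ⊢
      have h1 : (q.length : ℕ∞) < s :=
        lt_of_lt_of_le (by exact_mod_cast Nat.lt_succ_self _) hq
      have h2 := ih h1.le hb
      have h3 : H.Adj c a := hag c (hb c (h2.trans_lt h1)) a h.symm
      calc H.edist b a ≤ H.edist b c + H.edist c a := SimpleGraph.edist_triangle
        _ ≤ q.length + 1 := add_le_add h2 (SimpleGraph.edist_eq_one_iff_adj.2 h3).le
  by_cases htop : H'.edist x v = ⊤
  · rw [htop]; exact le_top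
  · obtain ⟨q, hq⟩ := SimpleGraph.exists_walk_of_edist_ne_top htop
    have := key q.reverse (by simpa [hq] using hv) hK
    simpa [hq] using this

/-- Applying `edist_le_edist_of_agree` in both directions shows that the event "the open ball is K"
depends only on the edges touching K. With `s = ⊤` the ball is the whole cluster. -/
lemma ball_eq_of_agree {H H' : SimpleGraph V} {K : Set V} {s : ℕ∞} {x : V}
    (hK : {v | H.edist x v < s} = K) (hag : ∀ u ∈ K, ∀ v, H.Adj u v ↔ H'.Adj u v) :
    {v | H'.edist x v < s} = K ∧
      ∀ v, H.edist x v ≤ s → H'.edist x v = H.edist x v := by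
  have hK1 : ∀ v, H.edist x v < s → v ∈ K := fun v hv => hK ▸ hv
  have l1 : ∀ v, H'.edist x v ≤ s → H.edist x v ≤ H'.edist x v := fun v hv =>
    edist_le_edist_of_agree hK1 (fun u hu v => (hag u hu v).2) hv
  have hK2 : ∀ v, H'.edist x v < s → v ∈ K := fun v hv => hK1 v ((l1 v hv.le).trans_lt hv)
  have l2 : ∀ v, H.edist x v ≤ s → H'.edist x v ≤ H.edist x v := fun v hv =>
    edist_le_edist_of_agree hK2 (fun u hu v => (hag u hu v).1) hv
  refine ⟨Set.eq_of_subset_of_subset hK2 fun v hv => ?_, fun v hv => ?_⟩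
  · rw [← hK] at hv
    exact (l2 v hv.le).trans_lt hv
  · exact le_antisymm (l2 v hv) (l1 v ((l2 v hv).trans hv))

variable [Fintype V] {G : SimpleGraph V} {p : ℝ}

/-- The expected size of the sphere of radius `r` around `x` off `A`. -/
noncomputable def sphereMass (G : SimpleGraph V) (p : ℝ) (x : V) (r : ℕ) (A : Set V) : ℝ :=
  ∑ y, prob G p (fun ω => (off ω A).edist x y = (r : ℕ∞))

lemma expect_ncard_sphereOff (x : V) (r : ℕ) (A : Set V) :
    expect G p (fun ω => ((sphereOff ω x r A).ncard : ℝ)) = sphereMass G p x r A :=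
  expect_ncard fun y ω => (off ω A).edist x y = (r : ℕ∞)

/-- The vertex `z` is at distance `s` from `x`, and `w` is at distance `t` from `z` and on a
geodesic from `x` through `z`, off `A`. -/
def OnGeodesic (A : Set V) (x z w : V) (s t : ℕ) (ω : SimpleGraph V) : Prop :=
  (off ω A).edist x z = s ∧ (off ω A).edist x w = (s + t : ℕ) ∧ (off ω A).edist z w = t

-- Along a geodesic the distance from `x` increases, so the stretch after `z` never returns to the
-- open ball of radius `s`. The ball is open, so `z` itself stays available.
omit [Fintype V] in
lemma OnGeodesic.edist_off_ball {A : Set V} {x z w : V} {s t : ℕ} {ω : SimpleGraph V}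
    (h : OnGeodesic A x z w s t ω) :
    (off ω (A ∪ {v | (off ω A).edist x v < s})).edist z w = t := by
  obtain ⟨h1, h2, h3⟩ := h
  set K := {v | (off ω A).edist x v < s}
  have key : ∀ {a b : V} (q : (off ω A).Walk a b), (off ω A).edist x b ≤ (s + t : ℕ) →
      (off ω A).edist x b = (off ω A).edist x a + q.length → (s : ℕ∞) ≤ (off ω A).edist x a →
      (off ω (A ∪ K)).edist a b ≤ q.length := by
    intro a b q
    induction q with
    | nil => intro _ _ _; simp
    | @cons a c b h q ih =>
      intro hb hab ha
      rw [SimpleGraph.Walk.length_cons] at hab ⊢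
      push_cast at hab ⊢
      have hac : (off ω A).edist x c ≤ (off ω A).edist x a + 1 :=
        SimpleGraph.edist_triangle.trans
          (add_le_add_right (SimpleGraph.edist_eq_one_iff_adj.2 h).le _)
      have hcb : (off ω A).edist x b ≤ (off ω A).edist x c + q.length :=
        SimpleGraph.edist_triangle.trans (add_le_add_right (SimpleGraph.edist_le q) _)
      have hne : (off ω A).edist x b ≠ ⊤ := ne_top_of_le_ne_top (ENat.natCast_ne_top _) hb
      have hne2 : (off ω A).edist x a ≠ ⊤ := by
        rintro h'; rw [h'] at hab; simp at hab; exact hne hab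
      have hne3 : (off ω A).edist x c ≠ ⊤ :=
        ne_top_of_le_ne_top (by simp [hne2]) hac
      obtain ⟨na, hna⟩ := ENat.ne_top_iff_exists.1 hne2
      obtain ⟨nb, hnb⟩ := ENat.ne_top_iff_exists.1 hne
      obtain ⟨nc, hnc⟩ := ENat.ne_top_iff_exists.1 hne3
      rw [← hna] at hab hac ha
      rw [← hnc] at hac hcb
      rw [← hnb] at hab hcb
      norm_cast at hab hac hcb ha
      have hc : nc = na + 1 := by omega
      have ih' := ih hb (by rw [← hnb, ← hnc]; norm_cast; omega)
        (by rw [← hnc]; norm_cast; omega)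
      have hadj : (off ω (A ∪ K)).Adj a c := by
        obtain ⟨g1, g2, g3⟩ := off_adj.1 h
        refine off_adj.2 ⟨g1, ?_, ?_⟩
        · rintro (h' | h')
          · exact g2 h'
          · have : (off ω A).edist x a < s := h'
            rw [← hna] at this; norm_cast at this; omega
        · rintro (h' | h')
          · exact g3 h'
          · have : (off ω A).edist x c < s := h'
            rw [← hnc] at this; norm_cast at this; omega
      calc (off ω (A ∪ K)).edist a b
          ≤ (off ω (A ∪ K)).edist a c + (off ω (A ∪ K)).edist c b :=
            SimpleGraph.edist_triangle
        _ ≤ 1 + q.length := add_le_add (SimpleGraph.edist_eq_one_iff_adj.2 hadj).le ih'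
        _ = q.length + 1 := add_comm _ _
  refine le_antisymm ?_ ?_
  · obtain ⟨q, hq⟩ := SimpleGraph.exists_walk_of_edist_eq_coe h3
    rw [← hq]
    exact key q h2.le (by rw [h1, h2, hq]; push_cast; rfl) h1.ge
  · rw [← h3]
    exact SimpleGraph.edist_anti (off_anti ω Set.subset_union_left)

/-- Conditionally on the ball of radius `s`, the process continues as in a fresh percolation. -/
lemma sum_prob_onGeodesic_le (h0 : 0 ≤ p) (h1 : p ≤ 1) (A : Set V) (x z : V) (s t : ℕ) {g : ℝ}
    (hg : ∀ A', sphereMass G p z t A' ≤ g) :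
    ∑ w, prob G p (OnGeodesic A x z w s t) ≤
      prob G p (fun ω => (off ω A).edist x z = s) * g := by
  classical
  -- Sum over the open ball K: the distance to `z` is read off the edges touching K, and the stretch
  -- from `z` to `w` uses only edges off A ∪ K.
  have step : ∀ w, prob G p (OnGeodesic A x z w s t) ≤
      ∑ K : Set V, prob G p (fun ω => {v | (off ω A).edist x v < s} = K ∧
        (off ω A).edist x z = s) * prob G p (fun ω => (off ω (A ∪ K)).edist z w = t) := by
    intro w
    rw [prob_eq_sum_fiber _ fun ω => {v | (off ω A).edist x v < s}]
    refine Finset.sum_le_sum fun K _ => ?_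
    rw [← prob_and_of_indep K]
    · refine prob_mono h0 h1 fun ω _ h => ?_
      obtain ⟨rfl, h⟩ := h
      exact ⟨⟨rfl, h.1⟩, h.edist_off_ball⟩
    · rintro ω ω' hag ⟨hK, hz⟩
      have hag' : ∀ u ∈ K, ∀ v, (off ω A).Adj u v ↔ (off ω' A).Adj u v := fun u hu v => by
        rw [off_adj, off_adj, hag u hu v]
      obtain ⟨e1, e2⟩ := ball_eq_of_agree hK hag'
      exact ⟨e1, (e2 z hz.le).trans hz⟩
    · intro ω ω' hag h
      have : off ω' (A ∪ K) = off ω (A ∪ K) := by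
        ext u v
        rw [off_adj, off_adj]
        constructor
        · rintro ⟨a, b, c⟩
          exact ⟨(hag u (fun h => b (Or.inr h)) v (fun h => c (Or.inr h))).2 a, b, c⟩
        · rintro ⟨a, b, c⟩
          exact ⟨(hag u (fun h => b (Or.inr h)) v (fun h => c (Or.inr h))).1 a, b, c⟩
      rw [this]; exact h
  calc ∑ w, prob G p (OnGeodesic A x z w s t)
      ≤ ∑ w, ∑ K : Set V, prob G p (fun ω => {v | (off ω A).edist x v < s} = K ∧
        (off ω A).edist x z = s) * prob G p (fun ω => (off ω (A ∪ K)).edist z w = t) :=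
        Finset.sum_le_sum fun w _ => step w
    _ = ∑ K : Set V, prob G p (fun ω => {v | (off ω A).edist x v < s} = K ∧
        (off ω A).edist x z = s) * sphereMass G p z t (A ∪ K) := by
        rw [Finset.sum_comm]; simp only [sphereMass, Finset.mul_sum]
    _ ≤ ∑ K : Set V, prob G p (fun ω => {v | (off ω A).edist x v < s} = K ∧
        (off ω A).edist x z = s) * g :=
        Finset.sum_le_sum fun K _ => mul_le_mul_of_nonneg_left (hg _) (prob_nonneg h0 h1 _)
    _ = _ := by
        rw [← Finset.sum_mul, prob_eq_sum_fiber (fun ω => (off ω A).edist x z = s)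
          fun ω => {v | (off ω A).edist x v < s}]

omit [Fintype V] in
/-- Every vertex at distance `s + t` is reached through a vertex at distance `s`. -/
lemma exists_onGeodesic {ω : SimpleGraph V} {A : Set V} {x w : V} {s t : ℕ}
    (h : (off ω A).edist x w = (s + t : ℕ)) : ∃ z, OnGeodesic A x z w s t ω := by
  obtain ⟨q, hq⟩ := SimpleGraph.exists_walk_of_edist_eq_coe h
  have e1 : (off ω A).edist x (q.getVert s) ≤ s :=
    (SimpleGraph.edist_le (q.take s)).trans (by rw [SimpleGraph.Walk.take_length]; simp)
  have e2 : (off ω A).edist (q.getVert s) w ≤ t :=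
    (SimpleGraph.edist_le (q.drop s)).trans (by rw [SimpleGraph.Walk.drop_length, hq]; simp)
  have e3 : (off ω A).edist x w ≤ (off ω A).edist x (q.getVert s) +
    (off ω A).edist (q.getVert s) w := SimpleGraph.edist_triangle
  obtain ⟨a, ha⟩ := ENat.ne_top_iff_exists.1 (ne_top_of_le_ne_top (ENat.natCast_ne_top _) e1)
  obtain ⟨b, hb⟩ := ENat.ne_top_iff_exists.1 (ne_top_of_le_ne_top (ENat.natCast_ne_top _) e2)
  refine ⟨q.getVert s, ?_, h, ?_⟩
  all_goals
    rw [h, ← ha, ← hb] at e3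
    rw [← ha] at e1
    rw [← hb] at e2
    norm_cast at e1 e2 e3
  · rw [← ha]; norm_cast; omega
  · rw [← hb]; norm_cast; omega

/-- Submultiplicativity of the expected sphere sizes. -/
lemma sphereMass_add_le (h0 : 0 ≤ p) (h1 : p ≤ 1) (A : Set V) (x : V) (s t : ℕ) {g : ℝ}
    (hg : ∀ z A', sphereMass G p z t A' ≤ g) :
    sphereMass G p x (s + t) A ≤ sphereMass G p x s A * g := by
  calc sphereMass G p x (s + t) A ≤ ∑ w, ∑ z, prob G p (OnGeodesic A x z w s t) :=
        Finset.sum_le_sum fun w _ => prob_le_sum h0 h1 _ fun ω _ h => by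
          obtain ⟨z, hz⟩ := exists_onGeodesic h
          exact ⟨z, Finset.mem_univ _, hz⟩
    _ = ∑ z, ∑ w, prob G p (OnGeodesic A x z w s t) := Finset.sum_comm
    _ ≤ ∑ z, prob G p (fun ω => (off ω A).edist x z = s) * g :=
        Finset.sum_le_sum fun z _ => sum_prob_onGeodesic_le h0 h1 A x z s t (hg z)
    _ = _ := by rw [← Finset.sum_mul, sphereMass]

end Exploration

/-! ### Paths, disjoint witnesses, tree skeletons and pivotal edges. -/

section Walks

variable {V : Type*}

/-- The graph formed by a list of edges. -/
def edgeGraph (l : List (Sym2 V)) : SimpleGraph V := SimpleGraph.fromEdgeSet {e | e ∈ l}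

lemma edgeGraph_le {ω : SimpleGraph V} {l : List (Sym2 V)} (h : ∀ e ∈ l, e ∈ ω.edgeSet) :
    edgeGraph l ≤ ω := by
  intro u v huv
  exact h _ (SimpleGraph.fromEdgeSet_adj _ |>.1 huv).1

lemma edgeGraph_disjoint {l l' : List (Sym2 V)} (h : l.Disjoint l') :
    Disjoint (edgeGraph l) (edgeGraph l') := by
  rw [← SimpleGraph.disjoint_edgeSet, Set.disjoint_left]
  intro e
  induction e with
  | _ u v =>
    intro h1 h2
    exact h (SimpleGraph.fromEdgeSet_adj _ |>.1 h1).1 (SimpleGraph.fromEdgeSet_adj _ |>.1 h2).1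

lemma mem_edgeSet_edgeGraph {ω : SimpleGraph V} {l : List (Sym2 V)}
    {e : Sym2 V} (he : e ∈ l) (h : e ∈ ω.edgeSet) : e ∈ (edgeGraph l).edgeSet := by
  induction e with
  | _ u v => exact (SimpleGraph.fromEdgeSet_adj _).2 ⟨he, SimpleGraph.Adj.ne h⟩

lemma Box.of_lists {I B : SimpleGraph V → Prop} {ω : SimpleGraph V} {l l' : List (Sym2 V)}
    (hl : ∀ e ∈ l, e ∈ ω.edgeSet) (hl' : ∀ e ∈ l', e ∈ ω.edgeSet) (h : l.Disjoint l')
    (hI : I (edgeGraph l)) (hB : B (edgeGraph l')) : Box I B ω :=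
  ⟨_, _, edgeGraph_le hl, edgeGraph_le hl', edgeGraph_disjoint h, hI, hB⟩

lemma reachable_edgeGraph {ω : SimpleGraph V} {l : List (Sym2 V)} {x y : V} (q : ω.Walk x y)
    (h : ∀ e ∈ q.edges, e ∈ l) : (edgeGraph l).Reachable x y :=
  ⟨q.transfer _ fun e he => mem_edgeSet_edgeGraph (h e he) (q.edges_subset_edgeSet he)⟩

lemma edist_off_edgeGraph {ω : SimpleGraph V} {A : Set V} {l : List (Sym2 V)} {x y : V}
    (q : (off ω A).Walk x y) (h : ∀ e ∈ q.edges, e ∈ l) :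
    (off (edgeGraph l) A).edist x y ≤ q.length := by
  refine (SimpleGraph.edist_le (q.transfer (off (edgeGraph l) A) fun e he => ?_)).trans_eq
    (by rw [SimpleGraph.Walk.length_transfer])
  have h1 := h e he
  have h2 := q.edges_subset_edgeSet he
  induction e with
  | _ u v =>
    obtain ⟨g1, g2⟩ := off_adj.1 h2
    exact off_adj.2 ⟨(SimpleGraph.fromEdgeSet_adj _).2 ⟨h1, g1.ne⟩, g2⟩

lemma exists_split {ω : SimpleGraph V} {x y : V} (q : ω.Walk x y) {n : ℕ} (hn : n ≤ q.length) :
    ∃ (z : V) (q₁ : ω.Walk x z) (q₂ : ω.Walk z y), q = q₁.append q₂ ∧ q₁.length = n :=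
  ⟨_, q.take n, q.drop n, (q.append_take_drop_eq n).symm, by
    rw [SimpleGraph.Walk.take_length, min_eq_left hn]⟩

lemma edges_disjoint_of_append {ω : SimpleGraph V} {x y z : V} {q₁ : ω.Walk x z} {q₂ : ω.Walk z y}
    (h : (q₁.append q₂).IsPath) : q₁.edges.Disjoint q₂.edges := by
  have := h.isTrail.edges_nodup
  rw [SimpleGraph.Walk.edges_append] at this
  exact List.disjoint_of_nodup_append this

/-- There is an open path of length exactly `t` from `x` to `y`. -/
def PathOfLength (t : ℕ) (x y : V) (ω : SimpleGraph V) : Prop :=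
  ∃ q : ω.Walk x y, q.IsPath ∧ q.length = t

/-- There is an open path of length exactly `t + 1` from `x` to `v` whose last edge is `(u, v)`. -/
def PathWithLastEdge (t : ℕ) (x u v : V) (ω : SimpleGraph V) : Prop :=
  ∃ q : ω.Walk x u, q.IsPath ∧ q.length = t ∧ v ∉ q.support ∧ ω.Adj u v

lemma PathOfLength.monotone (t : ℕ) (x y : V) : Monotone (PathOfLength t x y) := by
  rintro ω ω' h ⟨q, hq, hl⟩
  have he : ∀ e ∈ q.edges, e ∈ ω'.edgeSet := fun e he =>
    SimpleGraph.edgeSet_mono h (q.edges_subset_edgeSet he)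
  exact ⟨q.transfer ω' he, hq.transfer he, by simpa using hl⟩

lemma PathWithLastEdge.monotone (t : ℕ) (x u v : V) : Monotone (PathWithLastEdge t x u v) := by
  rintro ω ω' h ⟨q, hq, hl, hs, ha⟩
  have he : ∀ e ∈ q.edges, e ∈ ω'.edgeSet := fun e he =>
    SimpleGraph.edgeSet_mono h (q.edges_subset_edgeSet he)
  exact ⟨q.transfer ω' he, hq.transfer he, by simpa using hl, by simpa using hs, h ha⟩

lemma reachable_monotone (x y : V) : Monotone fun ω : SimpleGraph V => ω.Reachable x y :=
  fun _ _ h => SimpleGraph.Reachable.mono h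

lemma pathOfLength_edgeGraph {ω : SimpleGraph V} {l : List (Sym2 V)} {x y : V} {q : ω.Walk x y}
    (hq : q.IsPath) (h : ∀ e ∈ q.edges, e ∈ l) : PathOfLength q.length x y (edgeGraph l) := by
  have he : ∀ e ∈ q.edges, e ∈ (edgeGraph l).edgeSet :=
    fun e he => mem_edgeSet_edgeGraph (h e he) (q.edges_subset_edgeSet he)
  exact ⟨q.transfer _ he, hq.transfer he, by simp⟩

lemma PathOfLength.zero {x y : V} {ω : SimpleGraph V} (h : PathOfLength 0 x y ω) : x = y := by
  obtain ⟨q, -, hq⟩ := h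
  exact SimpleGraph.Walk.eq_of_length_eq_zero hq

lemma PathOfLength.exists_lastEdge {t : ℕ} {x v : V} {ω : SimpleGraph V}
    (h : PathOfLength (t + 1) x v ω) : ∃ u, PathWithLastEdge t x u v ω := by
  obtain ⟨q, hq, hl⟩ := h
  obtain ⟨u, q₁, q₂, rfl, h1⟩ := exists_split q (n := t) (by omega)
  rw [SimpleGraph.Walk.length_append, h1] at hl
  have h2 : q₂.length = 1 := by omega
  cases q₂ with
  | nil => simp at h2
  | cons hadj q₃ =>
    have h3 : q₃.length = 0 := by simpa using h2
    cases q₃ with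
    | cons _ _ => simp at h3
    | nil =>
      refine ⟨u, q₁, hq.of_append_left, h1, ?_, hadj⟩
      intro hv
      have := hq.support_nodup
      rw [SimpleGraph.Walk.support_append] at this
      exact List.disjoint_of_nodup_append this hv (by simp)

/-- The vertex `w` is not on the path, so the edge to `w` is new, hence disjoint from the path, and
does not backtrack. -/
lemma PathWithLastEdge.exists_prev {t : ℕ} {x v w : V} {ω : SimpleGraph V}
    (h : PathWithLastEdge (t + 1) x v w ω) :
    ∃ u, w ≠ u ∧ Box (PathWithLastEdge t x u v) (fun ω => ω.Adj v w) ω := by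
  obtain ⟨q, hq, hl, hs, ha⟩ := h
  have hd : q.edges.Disjoint [s(v, w)] := by
    intro e he he'
    rw [List.mem_singleton] at he'
    subst he'
    exact hs (q.snd_mem_support_of_mem_edges he)
  have hp : PathOfLength (t + 1) x v (edgeGraph q.edges) := hl ▸ pathOfLength_edgeGraph hq fun _ => id
  obtain ⟨u, hu⟩ := hp.exists_lastEdge
  refine ⟨u, ?_, ?_⟩
  · rintro rfl
    obtain ⟨-, -, -, -, hadj⟩ := hu
    exact hs (q.fst_mem_support_of_mem_edges (SimpleGraph.fromEdgeSet_adj _ |>.1 hadj).1)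
  · refine Box.of_lists (fun e he => q.edges_subset_edgeSet he) ?_ hd hu ?_
    · simpa using ha
    · exact (SimpleGraph.fromEdgeSet_adj _).2 ⟨by simp, ha.ne⟩

/-- A connection is realized by a short path, or it contains a path of given length. -/
lemma reachable_short_or_box {ω : SimpleGraph V} {x y : V} (h : ω.Reachable x y) (N : ℕ) :
    (∃ t ∈ Finset.range (N + 1), PathOfLength t x y ω) ∨
      ∃ u, Box (PathOfLength N x u) (fun ω => ω.Reachable u y) ω := by
  classical
  obtain ⟨q, hq⟩ := h.exists_isPath
  by_cases hl : q.length ≤ N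
  · exact Or.inl ⟨q.length, by simpa using Nat.lt_succ_of_le hl, q, hq, rfl⟩
  · obtain ⟨u, q₁, q₂, rfl, h1⟩ := exists_split q (n := N) (by omega)
    exact Or.inr ⟨u, Box.of_lists (fun e he => q₁.edges_subset_edgeSet he)
      (fun e he => q₂.edges_subset_edgeSet he) (edges_disjoint_of_append hq)
      (h1 ▸ pathOfLength_edgeGraph hq.of_append_left fun _ => id)
      (reachable_edgeGraph q₂ fun _ => id)⟩

/-- A connection either avoids `K` or passes through a vertex of `K`. -/
lemma reachable_off_or_box {ω : SimpleGraph V} {x y : V} (h : ω.Reachable x y) (K : Set V) :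
    (off ω K).Reachable x y ∨
      ∃ a ∈ K, Box (fun ω => ω.Reachable x a) (fun ω => ω.Reachable a y) ω := by
  classical
  obtain ⟨q, hq⟩ := h.exists_isPath
  by_cases hK : ∃ a ∈ K, a ∈ q.support
  · obtain ⟨a, ha, haq⟩ := hK
    obtain ⟨q₁, q₂, rfl⟩ := SimpleGraph.Walk.mem_support_iff_exists_append.1 haq
    exact Or.inr ⟨a, ha, Box.of_lists (fun e he => q₁.edges_subset_edgeSet he)
      (fun e he => q₂.edges_subset_edgeSet he) (edges_disjoint_of_append hq)
      (reachable_edgeGraph q₁ fun _ => id) (reachable_edgeGraph q₂ fun _ => id)⟩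
  · push Not at hK
    refine Or.inl ⟨q.transfer _ fun e he => ?_⟩
    have h2 := q.edges_subset_edgeSet he
    induction e with
    | _ u v =>
      exact off_adj.2 ⟨h2, fun hu => hK u hu (q.fst_mem_support_of_mem_edges he),
        fun hu => hK v hu (q.snd_mem_support_of_mem_edges he)⟩

/-- Stop the walk from `a` at the first vertex of `q`: every edge taken before starts off `q`, so it
is not an edge of `q`. -/
lemma exists_first_hit {ω : SimpleGraph V} {x y : V} (q : ω.Walk x y) {a : V}
    (b : ω.Walk a x) : ∃ z ∈ q.support, ∃ b' : ω.Walk a z, q.edges.Disjoint b'.edges := by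
  classical
  have key : ∀ {a x' : V} (b : ω.Walk a x'), x' ∈ q.support →
      ∃ z ∈ q.support, ∃ b' : ω.Walk a z, q.edges.Disjoint b'.edges := by
    intro a x' b hx'
    induction b with
    | nil => exact ⟨_, hx', SimpleGraph.Walk.nil, by simp⟩
    | @cons a c x' h b ih =>
      by_cases ha : a ∈ q.support
      · exact ⟨a, ha, SimpleGraph.Walk.nil, by simp⟩
      · obtain ⟨z, hz, b', hb'⟩ := ih hx'
        refine ⟨z, hz, SimpleGraph.Walk.cons h b', ?_⟩
        rw [SimpleGraph.Walk.edges_cons, List.disjoint_cons_right]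
        exact ⟨fun h' => ha (q.fst_mem_support_of_mem_edges h'), hb'⟩
  exact key b q.start_mem_support

/-- The skeleton of the connections in `{d(x, y) = r, x ↔ a}`: a geodesic from `x` to `y` through
vertices `z` and `w`, and a disjoint connection from `z` to `a`. -/
lemma exists_tree {ω : SimpleGraph V} {A : Set V} {x y a : V} {r : ℕ} (N : ℕ)
    (hd : (off ω A).edist x y = r) (ha : ω.Reachable x a) :
    ∃ s ∈ Finset.range (r + 1), ∃ z w,
      ((s : ℕ∞) ≤ (off ω A).edist x z ∧
        ((s + (r - s - min (r - s) N) : ℕ) : ℕ∞) ≤ (off ω A).edist x w) ∧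
      Box (fun ω => (off ω A).edist x z ≤ s ∧
          (off ω A).edist z w ≤ (r - s - min (r - s) N : ℕ))
        (Box (PathOfLength (min (r - s) N) w y) (fun ω => ω.Reachable z a)) ω := by
  classical
  obtain ⟨q, hq⟩ := SimpleGraph.exists_walk_of_edist_eq_coe hd
  have hqp : q.IsPath := by
    refine q.isPath_of_length_eq_dist ?_
    rw [SimpleGraph.dist, hd, hq]; rfl
  obtain ⟨b⟩ := ha.symm
  have hqe : ∀ e ∈ q.edges, e ∈ ω.edgeSet := fun e he =>
    SimpleGraph.edgeSet_mono (off_le ω A) (q.edges_subset_edgeSet he)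
  obtain ⟨z, hz, b', hb'⟩ := exists_first_hit (q.transfer ω hqe) b
  rw [SimpleGraph.Walk.support_transfer] at hz
  rw [SimpleGraph.Walk.edges_transfer] at hb'
  obtain ⟨q₁, q', rfl⟩ := SimpleGraph.Walk.mem_support_iff_exists_append.1 hz
  rw [SimpleGraph.Walk.length_append] at hq
  set s := q₁.length with hs
  have hq' : q'.length = r - s := by omega
  set t := r - s
  -- The last `min t N` steps are split off. If t ≤ N the middle piece is empty and w = z.
  obtain ⟨w, q₂, q₃, rfl, h2⟩ := exists_split q' (n := t - min t N) (by omega)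
  have h3 : q₃.length = min t N := by
    rw [SimpleGraph.Walk.length_append] at hq'; omega
  refine ⟨s, Finset.mem_range.2 (by omega), z, w, ⟨?_, ?_⟩, ?_⟩
  -- A shortcut to `z`, or to `w` below, would shorten the geodesic to `y`. These lower bounds form
  -- the decreasing event.
  · have e1 : (off ω A).edist x y ≤ (off ω A).edist x z + (off ω A).edist z y :=
      SimpleGraph.edist_triangle
    have e2 := SimpleGraph.edist_le (q₂.append q₃)
    rw [hd] at e1
    rw [hq'] at e2
    have e3 := e1.trans (add_le_add_right e2 _)
    by_cases htop : (off ω A).edist x z = ⊤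
    · rw [htop]; exact le_top
    · obtain ⟨c, hc⟩ := ENat.ne_top_iff_exists.1 htop
      rw [← hc] at e3 ⊢
      norm_cast at e3 ⊢
      omega
  · have e1 : (off ω A).edist x y ≤ (off ω A).edist x w + (off ω A).edist w y :=
      SimpleGraph.edist_triangle
    have e2 := SimpleGraph.edist_le q₃
    rw [hd] at e1
    rw [h3] at e2
    have e3 := e1.trans (add_le_add_right e2 _)
    by_cases htop : (off ω A).edist x w = ⊤
    · rw [htop]; exact le_top
    · obtain ⟨c, hc⟩ := ENat.ne_top_iff_exists.1 htop
      rw [← hc] at e3 ⊢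
      norm_cast at e3 ⊢
      omega
  · have hp3 : (q₂.append q₃).IsPath := hqp.of_append_right
    have d1 := edges_disjoint_of_append hqp
    have d2 := edges_disjoint_of_append hp3
    rw [SimpleGraph.Walk.edges_append] at d1
    simp only [SimpleGraph.Walk.edges_append, List.disjoint_append_left,
      List.disjoint_append_right] at d1 hb' hqe
    have m1 : ∀ e ∈ q₁.edges, e ∈ ω.edgeSet := fun e he => hqe e (by simp [he])
    have m2 : ∀ e ∈ q₂.edges, e ∈ ω.edgeSet := fun e he => hqe e (by simp [he])
    have m3 : ∀ e ∈ q₃.edges, e ∈ ω.edgeSet := fun e he => hqe e (by simp [he])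
    have m4 : ∀ e ∈ b'.edges, e ∈ ω.edgeSet := fun e he => b'.edges_subset_edgeSet he
    refine Box.of_lists (l := q₁.edges ++ q₂.edges) (l' := q₃.edges ++ b'.edges) ?_ ?_ ?_ ?_ ?_
    · intro e he
      rcases List.mem_append.1 he with h | h
      exacts [m1 e h, m2 e h]
    · intro e he
      rcases List.mem_append.1 he with h | h
      exacts [m3 e h, m4 e h]
    · simp only [List.disjoint_append_left, List.disjoint_append_right]
      tauto
    · exact ⟨edist_off_edgeGraph q₁ fun e he => List.mem_append_left _ he,
        h2 ▸ edist_off_edgeGraph q₂ fun e he => List.mem_append_right _ he⟩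
    · refine Box.of_lists (l := q₃.edges) (l' := b'.edges) ?_ ?_ hb'.2.2 ?_ ?_
      · exact fun e he => mem_edgeSet_edgeGraph (List.mem_append_left _ he) (m3 e he)
      · exact fun e he => mem_edgeSet_edgeGraph (List.mem_append_right _ he) (m4 e he)
      · have := pathOfLength_edgeGraph (l := q₃.edges) (q := q₃.transfer ω m3)
          (hp3.of_append_right.transfer m3) (by simp)
        rwa [SimpleGraph.Walk.length_transfer, h3] at this
      · exact (reachable_edgeGraph b' fun _ => id).symm

/-- The edge `(x, x')` is open and pivotal for the connection of `o` to `y`, and `x` is at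
distance `r` from `o` off `A` and without this edge. -/
def PivotalAt (A : Set V) (o : V) (r : ℕ) (x x' y : V) (ω : SimpleGraph V) : Prop :=
  ω.Adj x x' ∧ (off (ω.deleteEdges {s(x, x')}) A).edist o x = r ∧
    ¬ (ω.deleteEdges {s(x, x')}).Reachable o x' ∧ (ω.deleteEdges {s(x, x')}).Reachable x' y

lemma PivotalAt.reachable {A : Set V} {o : V} {r : ℕ} {x x' y : V} {ω : SimpleGraph V}
    (h : PivotalAt A o r x x' y ω) : ω.Reachable o y := by
  obtain ⟨h1, h2, -, h4⟩ := h
  have hx : (off (ω.deleteEdges {s(x, x')}) A).Reachable o x :=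
    SimpleGraph.reachable_of_edist_ne_top (by rw [h2]; exact ENat.natCast_ne_top _)
  exact (hx.mono ((off_le _ _).trans (SimpleGraph.deleteEdges_le _))).trans
    (h1.reachable.trans (h4.mono (SimpleGraph.deleteEdges_le _)))

/-- Follow a geodesic from `o` to `x₂`. Its first use of the first edge would start from `x₁`, since
`x₁'` is cut off from `o`; this would place `x₁` at distance less than `r`. -/
lemma PivotalAt.reachable_left {A : Set V} {o : V} {r : ℕ} {x₁ x₁' y₁ x₂ x₂' y₂ : V}
    {ω : SimpleGraph V} (h₁ : PivotalAt A o r x₁ x₁' y₁ ω) (h₂ : PivotalAt A o r x₂ x₂' y₂ ω) :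
    (ω.deleteEdges {s(x₁, x₁')}).Reachable o x₂ := by
  obtain ⟨a1, a2, a3, -⟩ := h₁
  obtain ⟨-, b2, -, -⟩ := h₂
  obtain ⟨q, hq⟩ := SimpleGraph.exists_walk_of_edist_eq_coe b2
  set ω₁ := ω.deleteEdges {s(x₁, x₁')}
  have key : ∀ {v o : V} (q : (off (ω.deleteEdges {s(x₂, x₂')}) A).Walk v o),
      ¬ ω₁.Reachable o x₁' →
      (ω₁.Reachable o v ∧ (off ω₁ A).edist o v ≤ q.length) ∨ (off ω₁ A).edist o x₁ < q.length := by
    intro v o q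
    induction q with
    | nil => intro _; exact Or.inl ⟨SimpleGraph.Reachable.refl _, by simp⟩
    | @cons v u o h q ih =>
      intro ho
      rw [SimpleGraph.Walk.length_cons]
      push_cast
      have hlt : (q.length : ℕ∞) < q.length + 1 := by exact_mod_cast Nat.lt_succ_self _
      rcases ih ho with ⟨c1, c2⟩ | c
      · by_cases he : s(u, v) = s(x₁, x₁')
        · rcases Sym2.eq_iff.1 he with ⟨rfl, rfl⟩ | ⟨rfl, rfl⟩
          · exact Or.inr (c2.trans_lt hlt)
          · exact absurd c1 ho
        · obtain ⟨g1, g2, g3⟩ := off_adj.1 h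
          have g4 : ω₁.Adj u v := SimpleGraph.deleteEdges_adj.2
            ⟨(SimpleGraph.deleteEdges_adj.1 g1).1.symm, he⟩
          refine Or.inl ⟨c1.trans g4.reachable, SimpleGraph.edist_triangle.trans
            (add_le_add c2 (SimpleGraph.edist_eq_one_iff_adj.2 (off_adj.2 ⟨g4, g3, g2⟩)).le)⟩
      · exact Or.inr (c.trans hlt)
  rcases key q.reverse a3 with h | h
  · exact h.1
  · rw [a2, SimpleGraph.Walk.length_reverse, hq] at h
    exact absurd h (lt_irrefl _)

/-- Two pivotal edges for the same connection at the same distance coincide. -/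
lemma PivotalAt.unique {A : Set V} {o : V} {r : ℕ} {x₁ x₁' x₂ x₂' y : V}
    {ω : SimpleGraph V} (h₁ : PivotalAt A o r x₁ x₁' y ω) (h₂ : PivotalAt A o r x₂ x₂' y ω) :
    x₁ = x₂ ∧ x₁' = x₂' := by
  have r12 := h₁.reachable_left h₂
  have r21 := h₂.reachable_left h₁
  obtain ⟨a1, a2, a3, a4⟩ := h₁
  obtain ⟨b1, b2, b3, b4⟩ := h₂
  by_cases he : s(x₂, x₂') = s(x₁, x₁')
  · rcases Sym2.eq_iff.1 he with ⟨rfl, rfl⟩ | ⟨rfl, rfl⟩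
    · exact ⟨rfl, rfl⟩
    · exact absurd r12 a3
  -- If the edges differ, `o` reaches `x₂'` without the first edge but not `y`, so the route from
  -- `x₂'` to `y` that avoids the second edge visits `x₁`. As `o` also reaches `x₁` without the
  -- second edge, it reaches `x₂'` without it, a contradiction.
  · exfalso
    have g : (ω.deleteEdges {s(x₁, x₁')}).Adj x₂ x₂' := SimpleGraph.deleteEdges_adj.2 ⟨b1, he⟩
    have r1 : (ω.deleteEdges {s(x₁, x₁')}).Reachable o x₂' := r12.trans g.reachable
    have hy : ¬ (ω.deleteEdges {s(x₁, x₁')}).Reachable o y := fun h => a3 (h.trans a4.symm)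
    obtain ⟨q⟩ := b4
    have key : ∀ {a y : V} (q : (ω.deleteEdges {s(x₂, x₂')}).Walk a y),
        (ω.deleteEdges {s(x₁, x₁')}).Reachable o a →
        ¬ (ω.deleteEdges {s(x₁, x₁')}).Reachable o y →
        (ω.deleteEdges {s(x₂, x₂')}).Reachable a x₁ := by
      intro a y q
      induction q with
      | nil => intro h h'; exact absurd h h'
      | @cons a c y h q ih =>
        intro ha hy
        by_cases hc : (ω.deleteEdges {s(x₁, x₁')}).Reachable o c
        · exact h.reachable.trans (ih hc hy)
        · by_cases he : s(a, c) = s(x₁, x₁')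
          · rcases Sym2.eq_iff.1 he with ⟨rfl, rfl⟩ | ⟨rfl, rfl⟩
            · exact SimpleGraph.Reachable.refl _
            · exact absurd ha a3
          · have g4 : (ω.deleteEdges {s(x₁, x₁')}).Adj a c := SimpleGraph.deleteEdges_adj.2
              ⟨(SimpleGraph.deleteEdges_adj.1 h).1, he⟩
            exact absurd (ha.trans g4.reachable) hc
    exact b3 (r21.trans (key q r1 hy).symm)

end Walks

/-! ### The non-backtracking walk and its domination of open paths. -/

section NonBacktracking

variable {V : Type*} [Fintype V] {G : SimpleGraph V} {m : ℕ}

/-- The mass transport principle on a finite transitive graph. -/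
lemma sum_comm_of_invariant (htrans : IsTransitive G) {F : V → V → ℝ}
    (hF : ∀ (φ : G ≃g G) x y, F (φ x) (φ y) = F x y) (x : V) : ∑ y, F x y = ∑ y, F y x := by
  have h1 : ∀ z, ∑ y, F z y = ∑ y, F x y := by
    intro z
    obtain ⟨φ, rfl⟩ := htrans x z
    rw [← Equiv.sum_comp φ.toEquiv]
    exact Finset.sum_congr rfl fun y _ => hF φ x y
  have h2 : ∀ z, ∑ y, F y z = ∑ y, F y x := by
    intro z
    obtain ⟨φ, rfl⟩ := htrans x z
    rw [← Equiv.sum_comp φ.toEquiv]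
    exact Finset.sum_congr rfl fun y _ => hF φ y x
  have h3 : ∑ z, ∑ y, F z y = ∑ z, ∑ y, F y z := Finset.sum_comm
  simp only [h1, h2, Finset.sum_const, nsmul_eq_mul] at h3
  have : ((Finset.univ : Finset V).card : ℝ) ≠ 0 := by
    exact_mod_cast (Finset.card_pos.2 ⟨x, Finset.mem_univ x⟩).ne'
  exact mul_left_cancel₀ this h3

open Classical in
lemma card_filter_adj (hdeg : ∀ x, deg G x = m) (x : V) :
    (Finset.univ.filter fun y => G.Adj x y).card = m := by
  rw [← hdeg x, deg, Set.ncard_eq_toFinset_card']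
  congr 1
  ext y; simp

open Classical in
lemma card_filter_adj_ne (hdeg : ∀ x, deg G x = m) {x u : V} (h : G.Adj x u) :
    (Finset.univ.filter fun y => G.Adj x y ∧ y ≠ u).card = m - 1 := by
  rw [← card_filter_adj hdeg x, ← Finset.card_erase_of_mem (a := u) (by simpa using h)]
  congr 1
  ext y; simp [and_comm]

lemma nbwEdgeLaw_nonneg (hdeg : ∀ x, deg G x = m) (hm : 1 ≤ m) (x : V) (t : ℕ) (u v : V) :
    0 ≤ nbwEdgeLaw G x t u v := by
  have hm' : (0 : ℝ) ≤ (m : ℝ) - 1 := by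
    rw [sub_nonneg]; exact_mod_cast hm
  induction t generalizing u v with
  | zero => rw [nbwEdgeLaw]; positivity
  | succ t ih =>
    rw [nbwEdgeLaw]
    refine Finset.sum_nonneg fun w _ => mul_nonneg (ih w u) ?_
    rw [hdeg]
    split_ifs
    · positivity
    · exact le_rfl

lemma nbwEdgeLaw_adj {x : V} {t : ℕ} {u v : V} (h : nbwEdgeLaw G x t u v ≠ 0) : G.Adj u v := by
  by_contra hadj
  apply h
  cases t with
  | zero => simp [nbwEdgeLaw, hadj]
  | succ t => simp [nbwEdgeLaw, hadj]

lemma nbwProb_nonneg (hdeg : ∀ x, deg G x = m) (hm : 1 ≤ m) (t : ℕ) (x y : V) :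
    0 ≤ nbwProb G t x y := by
  cases t with
  | zero => rw [nbwProb]; positivity
  | succ t => exact Finset.sum_nonneg fun u _ => nbwEdgeLaw_nonneg hdeg hm x t u y

lemma sum_nbwEdgeLaw (hdeg : ∀ x, deg G x = m) (hm : 2 ≤ m) (x : V) (t : ℕ) :
    ∑ v, ∑ u, nbwEdgeLaw G x t u v = 1 := by
  classical
  have hm0 : (m : ℝ) ≠ 0 := by positivity
  induction t with
  | zero =>
    simp only [nbwEdgeLaw, hdeg]
    have : ∀ v u : V, (if u = x ∧ G.Adj u v then 1 / (m : ℝ) else 0) =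
        if u = x then (if G.Adj x v then 1 / (m : ℝ) else 0) else 0 := by
      intro v u
      by_cases hu : u = x
      · subst hu; simp
      · simp [hu]
    simp only [this, Finset.sum_ite_eq', Finset.mem_univ, if_true]
    rw [← Finset.sum_filter, Finset.sum_const, card_filter_adj hdeg, nsmul_eq_mul]
    field_simp
  | succ t ih =>
    have step : ∀ v u, (∑ w, nbwEdgeLaw G x t u v *
        (if G.Adj v w ∧ w ≠ u then 1 / ((deg G v : ℝ) - 1) else 0)) = nbwEdgeLaw G x t u v := by
      intro v u
      by_cases h : nbwEdgeLaw G x t u v = 0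
      · simp [h]
      · rw [← Finset.mul_sum, ← Finset.sum_filter, Finset.sum_const,
          card_filter_adj_ne hdeg (nbwEdgeLaw_adj h).symm, nsmul_eq_mul, hdeg]
        have h1 : ((m - 1 : ℕ) : ℝ) = (m : ℝ) - 1 := by
          rw [Nat.cast_sub (by omega)]; simp
        have h2 : (m : ℝ) - 1 ≠ 0 := by
          have : (2 : ℝ) ≤ m := by exact_mod_cast hm
          linarith
        rw [h1, mul_one_div_cancel h2, mul_one]
    calc ∑ w, ∑ v, nbwEdgeLaw G x (t + 1) v w
        = ∑ w, ∑ v, ∑ u, nbwEdgeLaw G x t u v *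
            (if G.Adj v w ∧ w ≠ u then 1 / ((deg G v : ℝ) - 1) else 0) := by
          simp only [nbwEdgeLaw]
      _ = ∑ v, ∑ u, ∑ w, nbwEdgeLaw G x t u v *
            (if G.Adj v w ∧ w ≠ u then 1 / ((deg G v : ℝ) - 1) else 0) := by
          rw [Finset.sum_comm]
          exact Finset.sum_congr rfl fun v _ => Finset.sum_comm
      _ = 1 := by simp only [step]; exact ih

lemma sum_nbwProb (hdeg : ∀ x, deg G x = m) (hm : 2 ≤ m) (t : ℕ) (x : V) :
    ∑ y, nbwProb G t x y = 1 := by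
  cases t with
  | zero =>
    rw [Finset.sum_eq_single x]
    · simp [nbwProb]
    · intro y _ hy; simp [nbwProb, hy.symm]
    · simp
  | succ t => exact sum_nbwEdgeLaw hdeg hm x t

/-- Given the past, the last step hits a prescribed vertex with probability at most 1 / (m - 1). -/
lemma nbwProb_succ_le (hdeg : ∀ x, deg G x = m) (hm : 2 ≤ m) (t : ℕ) (x y : V) :
    nbwProb G (t + 1) x y ≤ 1 / ((m : ℝ) - 1) := by
  classical
  have hm2 : (2 : ℝ) ≤ m := by exact_mod_cast hm
  have hm1 : (0 : ℝ) < (m : ℝ) - 1 := by linarith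
  rw [nbwProb]
  cases t with
  | zero =>
    calc ∑ u, nbwEdgeLaw G x 0 u y ≤ ∑ u, if u = x then 1 / ((m : ℝ) - 1) else 0 := by
          refine Finset.sum_le_sum fun u _ => ?_
          rw [nbwEdgeLaw, hdeg]
          by_cases hu : u = x
          · rw [if_pos hu]
            split_ifs
            · exact one_div_le_one_div_of_le hm1 (by linarith)
            · positivity
          · simp [hu]
      _ = _ := by simp
  | succ t =>
    calc ∑ v, nbwEdgeLaw G x (t + 1) v y
        ≤ ∑ v, ∑ u, nbwEdgeLaw G x t u v * (1 / ((m : ℝ) - 1)) := by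
          refine Finset.sum_le_sum fun v _ => ?_
          rw [nbwEdgeLaw]
          refine Finset.sum_le_sum fun u _ => mul_le_mul_of_nonneg_left ?_
            (nbwEdgeLaw_nonneg hdeg (by omega) x t u v)
          rw [hdeg]
          split_ifs
          · exact le_rfl
          · positivity
      _ = _ := by
          simp only [← Finset.sum_mul]
          rw [sum_nbwEdgeLaw hdeg hm, one_mul]

/-- The two sides may carry different decidability instances. -/
lemma ite_congr_iff {P Q : Prop} {_ : Decidable P} {_ : Decidable Q} (h : P ↔ Q) (a b : ℝ) :
    (if P then a else b) = if Q then a else b := by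
  by_cases hP : P
  · rw [if_pos hP, if_pos (h.1 hP)]
  · rw [if_neg hP, if_neg fun hQ => hP (h.2 hQ)]

lemma nbwEdgeLaw_map (hdeg : ∀ x, deg G x = m) (φ : G ≃g G) (x : V) (t : ℕ) (u v : V) :
    nbwEdgeLaw G (φ x) t (φ u) (φ v) = nbwEdgeLaw G x t u v := by
  induction t generalizing u v with
  | zero =>
    rw [nbwEdgeLaw, nbwEdgeLaw, hdeg, hdeg]
    exact ite_congr_iff (and_congr φ.injective.eq_iff φ.map_adj_iff) _ _
  | succ t ih =>
    rw [nbwEdgeLaw, nbwEdgeLaw, ← Equiv.sum_comp φ.toEquiv]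
    refine Finset.sum_congr rfl fun w _ => ?_
    have e : φ.toEquiv w = φ w := rfl
    rw [e, ih, hdeg, hdeg]
    congr 1
    exact ite_congr_iff (and_congr φ.map_adj_iff φ.injective.ne_iff) _ _

lemma nbwProb_map (hdeg : ∀ x, deg G x = m) (φ : G ≃g G) (t : ℕ) (x y : V) :
    nbwProb G t (φ x) (φ y) = nbwProb G t x y := by
  cases t with
  | zero => exact ite_congr_iff φ.injective.eq_iff _ _
  | succ t =>
    rw [nbwProb, nbwProb, ← Equiv.sum_comp φ.toEquiv]
    exact Finset.sum_congr rfl fun w _ => nbwEdgeLaw_map hdeg φ x t w y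

/-- Mass transport turns column sums into row sums, so reversibility of the walk is not needed. -/
lemma sum_nbwProb_left (htrans : IsTransitive G) (hdeg : ∀ x, deg G x = m) (hm : 2 ≤ m) (t : ℕ)
    (y : V) : ∑ x, nbwProb G t x y = 1 := by
  rw [← sum_comm_of_invariant htrans (F := nbwProb G t) fun φ x y => nbwProb_map hdeg φ t x y]
  exact sum_nbwProb hdeg hm t y

variable {p : ℝ}

/-- A self-avoiding path does not backtrack, and the walk follows a given non-backtracking path of t
+ 1 edges with probability 1 / (m (m - 1)^t). Each edge costs one application of the van den
Berg-Kesten inequality. -/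
lemma prob_pathWithLastEdge_le (hdeg : ∀ x, deg G x = m) (hm : 2 ≤ m) (h0 : 0 ≤ p)
    (h2 : p ≤ 1 / 2) (t : ℕ) (x u v : V) :
    prob G p (PathWithLastEdge t x u v) ≤
      p ^ (t + 1) * m * ((m : ℝ) - 1) ^ t * nbwEdgeLaw G x t u v := by
  classical
  have h1 : p ≤ 1 := by linarith
  have hm2 : (2 : ℝ) ≤ m := by exact_mod_cast hm
  have hm1 : (m : ℝ) - 1 ≠ 0 := by linarith
  induction t generalizing u v with
  | zero =>
    by_cases hu : u = x
    · subst hu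
      refine (prob_mono h0 h1 (Y := fun ω => ω.Adj u v) fun ω _ h => ?_).trans
        ((prob_adj_le h0 u v).trans_eq ?_)
      · obtain ⟨-, -, -, -, h⟩ := h; exact h
      · rw [nbwEdgeLaw, hdeg]
        by_cases h : G.Adj u v
        · simp [h]; field_simp
        · simp [h]
    · rw [prob_false]
      · simp [nbwEdgeLaw, hu]
      · rintro ω _ ⟨q, -, hq, -⟩
        exact hu (SimpleGraph.Walk.eq_of_length_eq_zero hq).symm
  | succ t ih =>
    set c := p ^ (t + 1) * m * ((m : ℝ) - 1) ^ t
    have hc : 0 ≤ c := mul_nonneg (by positivity) (pow_nonneg (by linarith) _)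
    calc prob G p (PathWithLastEdge (t + 1) x u v)
        ≤ ∑ w, (if v ≠ w then prob G p (Box (PathWithLastEdge t x w u) (fun ω => ω.Adj u v)) else 0) := by
          rw [← Finset.sum_filter]
          refine prob_le_sum h0 h1 _ fun ω _ h => ?_
          obtain ⟨w, hw, hb⟩ := h.exists_prev
          exact ⟨w, by simpa using hw, hb⟩
      _ ≤ ∑ w, c * nbwEdgeLaw G x t w u * (if G.Adj u v ∧ v ≠ w then p else 0) := by
          refine Finset.sum_le_sum fun w _ => ?_
          by_cases hw : v ≠ w
          · rw [if_pos hw]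
            refine (prob_box_le h0 h2 (PathWithLastEdge.monotone t x w u)
              (fun _ _ h h' => h h')).trans ?_
            refine mul_le_mul (ih w u) ((prob_adj_le h0 u v).trans_eq ?_) (prob_nonneg h0 h1 _)
              (mul_nonneg hc (nbwEdgeLaw_nonneg hdeg (by omega) x t w u))
            simp [hw]
          · simp [hw]
      _ = p ^ (t + 1 + 1) * m * ((m : ℝ) - 1) ^ (t + 1) * nbwEdgeLaw G x (t + 1) u v := by
          rw [nbwEdgeLaw, Finset.mul_sum]
          refine Finset.sum_congr rfl fun w _ => ?_
          rw [hdeg]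
          split_ifs with h
          · simp only [c, pow_succ]; field_simp
          · simp

/-- Here `κ` bounds the ratio of path to walk weights up to time `N`; `1 ≤ κ` serves the trivial
path. -/
lemma prob_pathOfLength_le (hdeg : ∀ x, deg G x = m) (hm : 2 ≤ m) (h0 : 0 ≤ p)
    (h2 : p ≤ 1 / 2) {κ : ℝ} {N : ℕ} (hκ1 : 1 ≤ κ)
    (hκ : ∀ t < N, p ^ (t + 1) * m * ((m : ℝ) - 1) ^ t ≤ κ) {t : ℕ} (ht : t ≤ N) (x y : V) :
    prob G p (PathOfLength t x y) ≤ κ * nbwProb G t x y := by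
  classical
  have h1 : p ≤ 1 := by linarith
  cases t with
  | zero =>
    by_cases hxy : x = y
    · rw [nbwProb, if_pos hxy, mul_one]
      exact (prob_le_one h0 h1 _).trans hκ1
    · rw [prob_false fun ω _ h => hxy h.zero, nbwProb, if_neg hxy, mul_zero]
  | succ t =>
    rw [nbwProb, Finset.mul_sum]
    refine (prob_le_sum h0 h1 Finset.univ (Y := fun u => PathWithLastEdge t x u y)
      fun ω _ h => ?_).trans (Finset.sum_le_sum fun u _ => ?_)
    · obtain ⟨u, hu⟩ := h.exists_lastEdge
      exact ⟨u, Finset.mem_univ _, hu⟩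
    · exact (prob_pathWithLastEdge_le hdeg hm h0 h2 t x u y).trans
        (mul_le_mul_of_nonneg_right (hκ t (by omega)) (nbwEdgeLaw_nonneg hdeg (by omega) x t u y))

end NonBacktracking

/-! ### The two-point function, the gluing inequality and the tree-graph bound. -/

section Connectivity

variable {V : Type*} [Fintype V] {G : SimpleGraph V} {p : ℝ} {m : ℕ}

/-- The two-point function. -/
noncomputable def conn (G : SimpleGraph V) (p : ℝ) (x y : V) : ℝ :=
  prob G p (fun ω => ω.Reachable x y)

lemma conn_nonneg (h0 : 0 ≤ p) (h1 : p ≤ 1) (x y : V) : 0 ≤ conn G p x y := prob_nonneg h0 h1 _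

lemma conn_comm (x y : V) : conn G p x y = conn G p y x :=
  prob_congr fun _ _ => SimpleGraph.reachable_comm

lemma conn_self (x : V) : conn G p x x = 1 := by
  rw [conn, ← prob_true (G := G) (p := p)]
  exact prob_congr fun ω _ => by simp

lemma expectedClusterSize_eq_sum (x : V) : expectedClusterSize G p x = ∑ y, conn G p x y :=
  expect_ncard fun y ω => ω.Reachable x y

lemma conn_map (φ : G ≃g G) (x y : V) : conn G p (φ x) (φ y) = conn G p x y := by
  rw [conn, conn, prob, prob]
  conv_rhs => rw [← expect_comap φ]
  refine expect_congr fun ω _ => ?_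
  refine ite_congr_iff ?_ _ _
  exact SimpleGraph.Iso.reachable_iff (φ := SimpleGraph.Iso.comap φ.toEquiv ω)
    (u := x) (v := y)

lemma sum_conn_eq (htrans : IsTransitive G) (x z : V) :
    ∑ y, conn G p x y = ∑ y, conn G p z y := by
  obtain ⟨φ, rfl⟩ := htrans z x
  rw [← Equiv.sum_comp φ.toEquiv]
  exact Finset.sum_congr rfl fun y _ => conn_map φ z y

lemma one_le_sum_conn (h0 : 0 ≤ p) (h1 : p ≤ 1) (x : V) : 1 ≤ ∑ y, conn G p x y := by
  rw [← conn_self (G := G) (p := p) x]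
  exact Finset.single_le_sum (f := fun y => conn G p x y) (fun y _ => conn_nonneg h0 h1 x y)
    (Finset.mem_univ x)

lemma prob_or_le (h0 : 0 ≤ p) (h1 : p ≤ 1) (X Y : SimpleGraph V → Prop) :
    prob G p (fun ω => X ω ∨ Y ω) ≤ prob G p X + prob G p Y := by
  have := prob_le_sum (G := G) h0 h1 (Finset.univ : Finset Bool) (X := fun ω => X ω ∨ Y ω)
    (Y := fun b ω => if b then X ω else Y ω) fun ω _ h => by
      rcases h with h | h
      · exact ⟨true, Finset.mem_univ _, by simpa using h⟩
      · exact ⟨false, Finset.mem_univ _, by simpa using h⟩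
  simpa using this

/-- The uniform connection bound. -/
lemma conn_le (htrans : IsTransitive G) (hdeg : ∀ x, deg G x = m) (hm : 2 ≤ m) (h0 : 0 ≤ p)
    (h2 : p ≤ 1 / 2) {κ q : ℝ} {N : ℕ} (hκ1 : 1 ≤ κ)
    (hκ : ∀ t < N, p ^ (t + 1) * m * ((m : ℝ) - 1) ^ t ≤ κ)
    (hq : ∀ x y, nbwProb G N x y ≤ q) (o x y : V) :
    conn G p x y ≤ κ * ∑ t ∈ Finset.range (N + 1), nbwProb G t x y +
      κ * q * ∑ a, conn G p o a := by
  have h1 : p ≤ 1 := by linarith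
  have hκ0 : 0 ≤ κ := by linarith
  -- A connection is short, or it starts with a path of length exactly `N`, whose end is nearly
  -- uniform (factor `q`), followed by a disjoint connection.
  calc conn G p x y ≤ prob G p (fun ω => (∃ t ∈ Finset.range (N + 1), PathOfLength t x y ω) ∨
          ∃ u, Box (PathOfLength N x u) (fun ω => ω.Reachable u y) ω) :=
        prob_mono h0 h1 fun ω _ h => reachable_short_or_box h N
    _ ≤ _ := prob_or_le h0 h1 _ _
    _ ≤ _ := add_le_add
        (prob_le_sum h0 h1 (Finset.range (N + 1)) (Y := fun t => PathOfLength t x y)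
          fun ω _ h => h)
        (prob_le_sum h0 h1 Finset.univ
          (Y := fun u => Box (PathOfLength N x u) (fun ω => ω.Reachable u y))
          fun ω _ ⟨u, hu⟩ => ⟨u, Finset.mem_univ u, hu⟩)
    _ ≤ ∑ t ∈ Finset.range (N + 1), κ * nbwProb G t x y + ∑ u, κ * q * conn G p y u := by
        refine add_le_add (Finset.sum_le_sum fun t ht => ?_) (Finset.sum_le_sum fun u _ => ?_)
        · exact prob_pathOfLength_le hdeg hm h0 h2 hκ1 hκ
            (Nat.lt_succ_iff.1 (Finset.mem_range.1 ht)) x y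
        · refine (prob_box_le h0 h2 (PathOfLength.monotone N x u)
            (reachable_monotone u y)).trans ?_
          rw [conn_comm y u]
          refine mul_le_mul_of_nonneg_right ?_ (conn_nonneg h0 h1 u y)
          exact (prob_pathOfLength_le hdeg hm h0 h2 hκ1 hκ le_rfl x u).trans
            (mul_le_mul_of_nonneg_left (hq x u) hκ0)
    _ = _ := by rw [← Finset.mul_sum, ← Finset.mul_sum, sum_conn_eq htrans y o]

-- A connection destroyed by closing K passes through some `a` in K; by the van den Berg-Kesten
-- inequality each such `a` costs at most `conn G p x a` times χ.
open Classical in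
lemma sum_prob_reachable_off_ge (htrans : IsTransitive G) (h0 : 0 ≤ p) (h2 : p ≤ 1 / 2)
    (o x : V) (K : Set V) :
    (∑ y, conn G p o y) * (1 - ∑ a, if a ∈ K then conn G p x a else 0) ≤
      ∑ y, prob G p (fun ω => (off ω K).Reachable x y) := by
  have h1 : p ≤ 1 := by linarith
  have step : ∀ y, conn G p x y ≤ prob G p (fun ω => (off ω K).Reachable x y) +
      ∑ a, (if a ∈ K then conn G p x a else 0) * conn G p a y := by
    intro y
    calc conn G p x y ≤ prob G p (fun ω => (off ω K).Reachable x y ∨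
          ∃ a ∈ K, Box (fun ω => ω.Reachable x a) (fun ω => ω.Reachable a y) ω) :=
          prob_mono h0 h1 fun ω _ h => reachable_off_or_box h K
      _ ≤ _ := prob_or_le h0 h1 _ _
      _ ≤ _ := add_le_add le_rfl
          (prob_le_sum h0 h1 (Finset.univ.filter (· ∈ K))
            (Y := fun a => Box (fun ω => ω.Reachable x a) (fun ω => ω.Reachable a y))
            fun ω _ ⟨a, ha, h⟩ => ⟨a, by simpa using ha, h⟩)
      _ ≤ _ := by
          rw [Finset.sum_filter]
          refine add_le_add le_rfl (Finset.sum_le_sum fun a _ => ?_)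
          split_ifs
          · exact prob_box_le h0 h2 (reachable_monotone x a) (reachable_monotone a y)
          · simp
  have h3 := Finset.sum_le_sum fun y (_ : y ∈ Finset.univ) => step y
  rw [Finset.sum_add_distrib, Finset.sum_comm, sum_conn_eq htrans x o] at h3
  simp only [← Finset.mul_sum, sum_conn_eq htrans _ o, ← Finset.sum_mul] at h3
  linarith

/-- The probability that `x` is at distance `r` from `o` off `A` and that `x'` is connected to `y`
in a different cluster. -/
lemma sum_prob_separated_ge (htrans : IsTransitive G) (h0 : 0 ≤ p) (h2 : p ≤ 1 / 2)
    (o : V) (A : Set V) (r : ℕ) (x x' : V) :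
    (∑ y, conn G p o y) * (prob G p (fun ω => (off ω A).edist o x = r) -
        ∑ a, prob G p (fun ω => (off ω A).edist o x = r ∧ ω.Reachable o a) * conn G p x' a) ≤
      ∑ y, prob G p (fun ω => (off ω A).edist o x = r ∧ ¬ ω.Reachable o x' ∧
        ω.Reachable x' y) := by
  classical
  have h1 : p ≤ 1 := by linarith
  set χ := ∑ y, conn G p o y with hχ
  have hχ0 : 0 ≤ χ := Finset.sum_nonneg fun y _ => conn_nonneg h0 h1 o y
  -- The whole cluster K of `o` is revealed; what remains off K is independent of it.
  let P : Set V → ℝ := fun K => prob G p (fun ω => cluster ω o = K ∧ (off ω A).edist o x = r)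
  have hP0 : ∀ K, 0 ≤ P K := fun K => prob_nonneg h0 h1 _
  have hP1 : prob G p (fun ω => (off ω A).edist o x = r) = ∑ K, P K :=
    prob_eq_sum_fiber _ fun ω => cluster ω o
  have hP2 : ∀ a, prob G p (fun ω => (off ω A).edist o x = r ∧ ω.Reachable o a) =
      ∑ K, if a ∈ K then P K else 0 := by
    intro a
    rw [prob_eq_sum_fiber _ fun ω => cluster ω o]
    refine Finset.sum_congr rfl fun K _ => ?_
    split_ifs with ha
    · refine prob_congr fun ω _ => ⟨fun h => ⟨h.1, h.2.1⟩, fun h => ⟨h.1, h.2, ?_⟩⟩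
      have : a ∈ cluster ω o := h.1 ▸ ha
      exact this
    · refine prob_false fun ω _ h => ha ?_
      rw [← h.1]; exact h.2.2
  have step : ∀ y, ∑ K : Set V, (if x' ∈ K then 0 else
      P K * prob G p (fun ω => (off ω K).Reachable x' y)) ≤
      prob G p (fun ω => (off ω A).edist o x = r ∧ ¬ ω.Reachable o x' ∧ ω.Reachable x' y) := by
    intro y
    rw [prob_eq_sum_fiber (fun ω => (off ω A).edist o x = r ∧ ¬ ω.Reachable o x' ∧
      ω.Reachable x' y) fun ω => cluster ω o]
    refine Finset.sum_le_sum fun K _ => ?_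
    split_ifs with hK
    · exact prob_nonneg h0 h1 _
    · simp only [P]
      rw [← prob_and_of_indep K]
      · refine prob_mono h0 h1 fun ω _ h => ⟨h.1.1, h.1.2, fun hr => hK ?_, h.2.mono (off_le _ _)⟩
        rw [← h.1.1]; exact hr
      · rintro ω ω' hag ⟨hc, hd⟩
        -- The cluster is treated as the open ball of infinite radius.
        have htop : ∀ H : SimpleGraph V, {v | H.edist o v < ⊤} = cluster H o := fun H => by
          ext v
          exact lt_top_iff_ne_top.trans SimpleGraph.edist_ne_top_iff_reachable
        have e1 := (ball_eq_of_agree (s := ⊤) ((htop ω).trans hc) hag).1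
        refine ⟨(htop ω').symm.trans e1, ?_⟩
        have hd' : (off ω' A).edist o x = (off ω A).edist o x := by
          have hagA : ∀ u ∈ K, ∀ v, (off ω A).Adj u v ↔ (off ω' A).Adj u v := fun u hu v => by
            rw [off_adj, off_adj, hag u hu v]
          have hsub : ∀ v ∈ {v | (off ω A).edist o v < ⊤}, v ∈ K := by
            intro v hv
            rw [htop] at hv
            rw [← hc]
            exact SimpleGraph.Reachable.mono (off_le ω A) hv
          exact (ball_eq_of_agree (s := ⊤) rfl fun u hu v => hagA u (hsub u hu) v).2 x le_top
        rw [hd', hd]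
      · intro ω ω' hag h
        have : off ω' K = off ω K := by
          ext u v
          rw [off_adj, off_adj]
          constructor
          · rintro ⟨a, b, c⟩
            exact ⟨(hag u b v c).2 a, b, c⟩
          · rintro ⟨a, b, c⟩
            exact ⟨(hag u b v c).1 a, b, c⟩
        rw [this]; exact h
  calc χ * (prob G p (fun ω => (off ω A).edist o x = r) -
        ∑ a, prob G p (fun ω => (off ω A).edist o x = r ∧ ω.Reachable o a) * conn G p x' a)
      = ∑ K, P K * (χ * (1 - ∑ a, if a ∈ K then conn G p x' a else 0)) := by
        rw [hP1]
        simp only [hP2, Finset.sum_mul]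
        rw [Finset.sum_comm, ← Finset.sum_sub_distrib, Finset.mul_sum]
        refine Finset.sum_congr rfl fun K _ => ?_
        have : ∑ a, (if a ∈ K then P K else 0) * conn G p x' a =
            P K * ∑ a, if a ∈ K then conn G p x' a else 0 := by
          rw [Finset.mul_sum]
          refine Finset.sum_congr rfl fun a _ => ?_
          split_ifs <;> simp
        rw [this]; ring
    _ ≤ ∑ K, if x' ∈ K then 0 else
          P K * ∑ y, prob G p (fun ω => (off ω K).Reachable x' y) := by
        refine Finset.sum_le_sum fun K _ => ?_
        split_ifs with hK
        -- If x' lies in K, the term a = x' alone makes the bracket nonpositive.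
        · refine mul_nonpos_of_nonneg_of_nonpos (hP0 K)
            (mul_nonpos_of_nonneg_of_nonpos hχ0 ?_)
          have : (1 : ℝ) ≤ ∑ a, if a ∈ K then conn G p x' a else 0 := by
            refine le_trans ?_ (Finset.single_le_sum (f := fun a => if a ∈ K then conn G p x' a
              else 0) (fun a _ => ?_) (Finset.mem_univ x'))
            · simp [hK, conn_self]
            · split_ifs
              · exact conn_nonneg h0 h1 _ _
              · exact le_rfl
          linarith
        · exact mul_le_mul_of_nonneg_left (sum_prob_reachable_off_ge htrans h0 h2 o x' K) (hP0 K)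
    _ = ∑ y, ∑ K : Set V, (if x' ∈ K then 0 else
          P K * prob G p (fun ω => (off ω K).Reachable x' y)) := by
        rw [Finset.sum_comm]
        refine Finset.sum_congr rfl fun K _ => ?_
        split_ifs
        · simp
        · rw [Finset.mul_sum]
    _ ≤ _ := Finset.sum_le_sum fun y _ => step y

/-- On the separated event the edge must be closed, and opening it produces `PivotalAt`. The flip
identity has a factor 1 - p on the right, which is dropped. -/
lemma mul_prob_separated_le_prob_pivotalAt (h0 : 0 ≤ p) (h1 : p < 1) (A : Set V) (o : V)
    (r : ℕ) {x x' : V} (hadj : G.Adj x x') (y : V) :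
    p * prob G p (fun ω => (off ω A).edist o x = r ∧ ¬ ω.Reachable o x' ∧ ω.Reachable x' y) ≤
      prob G p (PivotalAt A o r x x' y) := by
  have h := prob_open_edge_eq (p := p) hadj fun ω => (off ω A).edist o x = r ∧
    ¬ ω.Reachable o x' ∧ ω.Reachable x' y
  have h3 : prob G p (fun ω => (off ω A).edist o x = r ∧ ¬ ω.Reachable o x' ∧
      ω.Reachable x' y) = prob G p (fun ω => ¬ ω.Adj x x' ∧ (off ω A).edist o x = r ∧
      ¬ ω.Reachable o x' ∧ ω.Reachable x' y) := by
    refine prob_congr fun ω _ => ⟨fun h => ⟨fun ha => h.2.1 ?_, h⟩, fun h => h.2⟩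
    have hx : (off ω A).Reachable o x :=
      SimpleGraph.reachable_of_edist_ne_top (by rw [h.1]; exact ENat.natCast_ne_top _)
    exact (hx.mono (off_le _ _)).trans ha.reachable
  rw [h3, ← h]
  refine (mul_le_of_le_one_left (prob_nonneg h0 h1.le _) (by linarith)).trans_eq rfl

/-- For each `y` at most one pair (x, x') is pivotal at level `r`, and its existence forces a
connection from `o` to `y`. -/
lemma sum_prob_pivotalAt_le (h0 : 0 ≤ p) (h1 : p ≤ 1) (A : Set V) (o : V) (r : ℕ) :
    ∑ x, ∑ x', ∑ y, prob G p (PivotalAt A o r x x' y) ≤ ∑ y, conn G p o y := by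
  classical
  have key : ∀ y, ∑ e : V × V, prob G p (PivotalAt A o r e.1 e.2 y) ≤ conn G p o y := by
    intro y
    simp only [prob, conn]
    rw [← expect_sum]
    refine expect_mono h0 h1 fun ω _ => ?_
    by_cases h : ∃ e : V × V, PivotalAt A o r e.1 e.2 y ω
    · obtain ⟨e, he⟩ := h
      rw [Finset.sum_eq_single e, if_pos he, if_pos he.reachable]
      · intro e' _ hne
        rw [if_neg]
        intro he'
        obtain ⟨h1, h2⟩ := he'.unique he
        exact hne (Prod.ext h1 h2)
      · simp
    · push Not at h
      rw [Finset.sum_eq_zero fun e _ => by rw [if_neg (h e)]]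
      positivity
  calc ∑ x, ∑ x', ∑ y, prob G p (PivotalAt A o r x x' y)
      = ∑ y, ∑ e : V × V, prob G p (PivotalAt A o r e.1 e.2 y) := by
        symm
        rw [Finset.sum_comm, Fintype.sum_prod_type]
    _ ≤ _ := Finset.sum_le_sum fun y _ => key y

open Classical in
/-- The gluing error of the sphere of radius `r` off `A`. -/
noncomputable def glueError (G : SimpleGraph V) (p : ℝ) (A : Set V) (o : V) (r : ℕ) : ℝ :=
  p * ∑ x, ∑ x', if G.Adj x x' then ∑ a, prob G p (fun ω => (off ω A).edist o x = r ∧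
    ω.Reachable o a) * conn G p x' a else 0

/-- Gluing an independent cluster to the vertices of a sphere. -/
lemma mul_sphereMass_le_one_add (htrans : IsTransitive G) (hdeg : ∀ x, deg G x = m)
    (h0 : 0 ≤ p) (h2 : p ≤ 1 / 2) (A : Set V) (o : V) (r : ℕ) :
    p * m * sphereMass G p o r A ≤ 1 + glueError G p A o r := by
  classical
  have h1 : p ≤ 1 := by linarith
  set χ := ∑ y, conn G p o y with hχ
  have hχ1 : 1 ≤ χ := one_le_sum_conn h0 h1 o
  have e1 : χ * (p * m * sphereMass G p o r A - glueError G p A o r) ≤ χ * 1 := by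
    rw [mul_one]
    refine le_trans ?_ (sum_prob_pivotalAt_le h0 h1 A o r)
    have e2 : p * m * sphereMass G p o r A = p * ∑ x, ∑ x', if G.Adj x x' then
        prob G p (fun ω => (off ω A).edist o x = r) else 0 := by
      rw [mul_assoc, sphereMass, Finset.mul_sum]
      congr 1
      refine Finset.sum_congr rfl fun x _ => ?_
      rw [← Finset.sum_filter, Finset.sum_const, nsmul_eq_mul, card_filter_adj hdeg]
    rw [e2, glueError, ← mul_sub, ← Finset.sum_sub_distrib, ← mul_assoc, Finset.mul_sum]
    refine Finset.sum_le_sum fun x _ => ?_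
    rw [← Finset.sum_sub_distrib, Finset.mul_sum]
    refine Finset.sum_le_sum fun x' _ => ?_
    split_ifs with hadj
    · calc _ = p * (χ * (prob G p (fun ω => (off ω A).edist o x = r) -
          ∑ a, prob G p (fun ω => (off ω A).edist o x = r ∧ ω.Reachable o a) *
            conn G p x' a)) := by ring
        _ ≤ p * ∑ y, prob G p (fun ω => (off ω A).edist o x = r ∧ ¬ ω.Reachable o x' ∧
              ω.Reachable x' y) :=
            mul_le_mul_of_nonneg_left (sum_prob_separated_ge htrans h0 h2 o A r x x') h0
        _ ≤ _ := by
            rw [Finset.mul_sum]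
            exact Finset.sum_le_sum fun y _ =>
              mul_prob_separated_le_prob_pivotalAt h0 (by linarith) A o r hadj y
    · rw [sub_self, mul_zero]
      exact Finset.sum_nonneg fun y _ => prob_nonneg h0 h1 _
  have := le_of_mul_le_mul_left e1 (by linarith)
  linarith

/-- The tree-graph bound for a sphere and a connection. -/
lemma prob_edist_and_reachable_le (h0 : 0 ≤ p) (h2 : p ≤ 1 / 2) (A : Set V) (x y a : V)
    (r N : ℕ) :
    prob G p (fun ω => (off ω A).edist x y = r ∧ ω.Reachable x a) ≤
      ∑ s ∈ Finset.range (r + 1), ∑ z, ∑ w,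
        prob G p (OnGeodesic A x z w s (r - s - min (r - s) N)) *
          (prob G p (PathOfLength (min (r - s) N) w y) * conn G p z a) := by
  classical
  have h1 : p ≤ 1 := by linarith
  let D : ℕ → V → V → SimpleGraph V → Prop := fun s z w ω => (s : ℕ∞) ≤ (off ω A).edist x z ∧
        ((s + (r - s - min (r - s) N) : ℕ) : ℕ∞) ≤ (off ω A).edist x w
  let I : ℕ → V → V → SimpleGraph V → Prop := fun s z w ω => (off ω A).edist x z ≤ s ∧
          (off ω A).edist z w ≤ (r - s - min (r - s) N : ℕ)
  let B : ℕ → V → V → SimpleGraph V → Prop := fun s z w =>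
    Box (PathOfLength (min (r - s) N) w y) (fun ω => ω.Reachable z a)
  have hD : ∀ s z w, Antitone (D s z w) := fun s z w ω ω' h h' =>
    ⟨h'.1.trans (SimpleGraph.edist_anti (off_mono h A)),
      h'.2.trans (SimpleGraph.edist_anti (off_mono h A))⟩
  have hI : ∀ s z w, Monotone (I s z w) := fun s z w ω ω' h h' =>
    ⟨(SimpleGraph.edist_anti (off_mono h A)).trans h'.1,
      (SimpleGraph.edist_anti (off_mono h A)).trans h'.2⟩
  calc prob G p (fun ω => (off ω A).edist x y = r ∧ ω.Reachable x a)
      ≤ ∑ i ∈ Finset.range (r + 1) ×ˢ (Finset.univ : Finset (V × V)),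
        prob G p (fun ω => D i.1 i.2.1 i.2.2 ω ∧ Box (I i.1 i.2.1 i.2.2) (B i.1 i.2.1 i.2.2) ω) := by
        refine prob_le_sum h0 h1 _ fun ω _ h => ?_
        obtain ⟨s, hs, z, w, hd⟩ := exists_tree N h.1 h.2
        exact ⟨(s, z, w), Finset.mem_product.2 ⟨hs, Finset.mem_univ _⟩, hd⟩
    _ = ∑ s ∈ Finset.range (r + 1), ∑ z, ∑ w,
        prob G p (fun ω => D s z w ω ∧ Box (I s z w) (B s z w) ω) := by
        rw [Finset.sum_product]
        exact Finset.sum_congr rfl fun s _ => Fintype.sum_prod_type _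
    _ ≤ _ := by
        refine Finset.sum_le_sum fun s _ => Finset.sum_le_sum fun z _ =>
          Finset.sum_le_sum fun w _ => ?_
        refine (prob_and_box_le h0 h2 (hD s z w) (hI s z w) (Box.monotone _ _)).trans ?_
        refine mul_le_mul (prob_mono h0 h1 fun ω _ h => ?_)
          (prob_box_le h0 h2 (PathOfLength.monotone _ _ _) (reachable_monotone z a))
          (prob_nonneg h0 h1 _) (prob_nonneg h0 h1 _)
        -- The triangle inequality squeezes all three distances to their exact values.
        obtain ⟨⟨d1, d2⟩, i1, i2⟩ := h
        have e3 : (off ω A).edist x w ≤ (off ω A).edist x z + (off ω A).edist z w :=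
          SimpleGraph.edist_triangle
        obtain ⟨α, hα⟩ := ENat.ne_top_iff_exists.1
          (ne_top_of_le_ne_top (ENat.natCast_ne_top _) i1)
        obtain ⟨β, hβ⟩ := ENat.ne_top_iff_exists.1
          (ne_top_of_le_ne_top (ENat.natCast_ne_top _) i2)
        obtain ⟨γ, hγ⟩ := ENat.ne_top_iff_exists.1
          (ne_top_of_le_ne_top (by rw [← hα, ← hβ]; exact ENat.natCast_ne_top (α + β)) e3)
        rw [OnGeodesic, ← hα, ← hβ, ← hγ]
        rw [← hα, ← hβ, ← hγ] at e3
        rw [← hα] at d1 i1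
        rw [← hβ] at i2
        rw [← hγ] at d2
        norm_cast at *
        omega

end Connectivity

/-! ### Triangles, loops and the size of the gluing error. -/

section ErrorBounds

variable {V : Type*} [Fintype V] {G : SimpleGraph V} {p : ℝ} {m : ℕ}

/-- The expected number of visits of the non-backtracking walk up to time `N`. -/
noncomputable def nbwGreen (G : SimpleGraph V) (N : ℕ) (x y : V) : ℝ :=
  ∑ t ∈ Finset.range (N + 1), nbwProb G t x y

lemma nbwGreen_nonneg (hdeg : ∀ x, deg G x = m) (hm : 1 ≤ m) (N : ℕ) (x y : V) :
    0 ≤ nbwGreen G N x y :=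
  Finset.sum_nonneg fun t _ => nbwProb_nonneg hdeg hm t x y

lemma nbwGreen_map (hdeg : ∀ x, deg G x = m) (φ : G ≃g G) (N : ℕ) (x y : V) :
    nbwGreen G N (φ x) (φ y) = nbwGreen G N x y :=
  Finset.sum_congr rfl fun t _ => nbwProb_map hdeg φ t x y

lemma sum_nbwGreen (hdeg : ∀ x, deg G x = m) (hm : 2 ≤ m) (N : ℕ) (x : V) :
    ∑ y, nbwGreen G N x y = N + 1 := by
  simp only [nbwGreen]
  rw [Finset.sum_comm]
  simp [sum_nbwProb hdeg hm]

lemma sum_nbwGreen_left (htrans : IsTransitive G) (hdeg : ∀ x, deg G x = m) (hm : 2 ≤ m) (N : ℕ)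
    (y : V) : ∑ x, nbwGreen G N x y = N + 1 := by
  simp only [nbwGreen]
  rw [Finset.sum_comm]
  simp [sum_nbwProb_left htrans hdeg hm]

/-- One nontrivial walk provides the factor 1 / (m - 1), and row and column sums remove the other
two. Three trivial walks would force x = y. -/
lemma sum_nbwProb_triple_le (htrans : IsTransitive G) (hdeg : ∀ x, deg G x = m) (hm : 2 ≤ m)
    (a b c : ℕ) {x y : V} (hxy : x ≠ y) :
    ∑ u, ∑ v, nbwProb G a x u * nbwProb G b u v * nbwProb G c v y ≤ 1 / ((m : ℝ) - 1) := by
  classical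
  have hm2 : (2 : ℝ) ≤ m := by exact_mod_cast hm
  have hm1 : 0 ≤ 1 / ((m : ℝ) - 1) := by
    have : 0 < (m : ℝ) - 1 := by linarith
    positivity
  have nn := fun t x y => nbwProb_nonneg (G := G) hdeg (by omega : 1 ≤ m) t x y
  have rows := fun t x => sum_nbwProb (G := G) hdeg hm t x
  have cols := fun t y => sum_nbwProb_left htrans hdeg hm t y
  cases a with
  | succ a =>
    calc _ ≤ ∑ u, ∑ v, 1 / ((m : ℝ) - 1) * nbwProb G b u v * nbwProb G c v y := by
          refine Finset.sum_le_sum fun u _ => Finset.sum_le_sum fun v _ => ?_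
          exact mul_le_mul_of_nonneg_right (mul_le_mul_of_nonneg_right
            (nbwProb_succ_le hdeg hm a x u) (nn _ _ _)) (nn _ _ _)
      _ = _ := by
          rw [Finset.sum_comm]
          simp only [← Finset.sum_mul, ← Finset.mul_sum, cols, mul_one]
  | zero =>
    cases c with
    | succ c =>
      calc _ ≤ ∑ u, ∑ v, nbwProb G 0 x u * nbwProb G b u v * (1 / ((m : ℝ) - 1)) := by
            refine Finset.sum_le_sum fun u _ => Finset.sum_le_sum fun v _ => ?_
            exact mul_le_mul_of_nonneg_left (nbwProb_succ_le hdeg hm c v y)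
              (mul_nonneg (nn _ _ _) (nn _ _ _))
        _ = _ := by
            simp only [← Finset.sum_mul, ← Finset.mul_sum, rows, mul_one, one_mul]
    | zero =>
      have h0 : ∀ (f : V → ℝ) (x : V), ∑ u, nbwProb G 0 x u * f u = f x := by
        intro f x
        rw [Finset.sum_eq_single x]
        · simp [nbwProb]
        · intro u _ hu; simp [nbwProb, hu.symm]
        · simp
      have h0' : ∀ (f : V → ℝ) (y : V), ∑ v, f v * nbwProb G 0 v y = f y := by
        intro f x
        rw [Finset.sum_eq_single x]
        · simp [nbwProb]
        · intro u _ hu; simp [nbwProb, hu]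
        · simp
      have : ∑ u, ∑ v, nbwProb G 0 x u * nbwProb G b u v * nbwProb G 0 v y = nbwProb G b x y := by
        simp only [h0' fun v => nbwProb G 0 x _ * nbwProb G b _ v]
        exact h0 (fun u => nbwProb G b u y) x
      rw [this]
      cases b with
      | zero => rw [nbwProb, if_neg hxy]; exact hm1
      | succ b => exact nbwProb_succ_le hdeg hm b x y

lemma sum_nbwGreen_triple_eq (N : ℕ) (x y : V) :
    ∑ u, ∑ v, nbwGreen G N x u * nbwGreen G N u v * nbwGreen G N v y =
      ∑ t₁ ∈ Finset.range (N + 1), ∑ t₂ ∈ Finset.range (N + 1), ∑ t₃ ∈ Finset.range (N + 1),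
        ∑ u, ∑ v, nbwProb G t₁ x u * nbwProb G t₂ u v * nbwProb G t₃ v y := by
  have h : ∀ u v, nbwGreen G N x u * nbwGreen G N u v * nbwGreen G N v y =
      ∑ t₁ ∈ Finset.range (N + 1), ∑ t₂ ∈ Finset.range (N + 1), ∑ t₃ ∈ Finset.range (N + 1),
        nbwProb G t₁ x u * nbwProb G t₂ u v * nbwProb G t₃ v y := by
    intro u v
    rw [nbwGreen, nbwGreen, nbwGreen, Finset.sum_mul_sum, Finset.sum_mul]
    refine Finset.sum_congr rfl fun t₁ _ => ?_
    rw [Finset.sum_mul_sum]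
  simp only [h]
  simp only [Finset.sum_comm (s := (Finset.univ : Finset V)) (t := Finset.range (N + 1))]

lemma nbwTriangle_eq (N : ℕ) (x y : V) :
    nbwTriangle G N x y =
      ∑ t₁ ∈ Finset.range (N + 1), ∑ t₂ ∈ Finset.range (N + 1), ∑ t₃ ∈ Finset.range (N + 1),
        if 3 ≤ t₁ + t₂ + t₃ then
          ∑ u, ∑ v, nbwProb G t₁ x u * nbwProb G t₂ u v * nbwProb G t₃ v y else 0 := by
  rw [nbwTriangle]
  simp only [Finset.sum_comm (s := (Finset.univ : Finset V)) (t := Finset.range (N + 1))]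
  refine Finset.sum_congr rfl fun t₁ _ => Finset.sum_congr rfl fun t₂ _ =>
    Finset.sum_congr rfl fun t₃ _ => ?_
  split_ifs <;> simp

/-- There are at most `27` triples of natural numbers with sum less than `3`. -/
lemma sum_ite_lt_three_le (N : ℕ) :
    (∑ t₁ ∈ Finset.range (N + 1), ∑ t₂ ∈ Finset.range (N + 1), ∑ t₃ ∈ Finset.range (N + 1),
      if 3 ≤ t₁ + t₂ + t₃ then (0 : ℝ) else 1) ≤ 27 := by
  have h3 : (∑ t ∈ Finset.range (N + 1), if t < 3 then (1 : ℝ) else 0) ≤ 3 := by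
    rw [← Finset.sum_filter, Finset.sum_const, nsmul_eq_mul, mul_one]
    have : ((Finset.range (N + 1)).filter (· < 3)).card ≤ (Finset.range 3).card :=
      Finset.card_le_card fun t ht => Finset.mem_range.2 (Finset.mem_filter.1 ht).2
    rw [Finset.card_range] at this
    exact_mod_cast this
  have h0 : (0 : ℝ) ≤ ∑ t ∈ Finset.range (N + 1), if t < 3 then (1 : ℝ) else 0 :=
    Finset.sum_nonneg fun t _ => by positivity
  calc _ ≤ ∑ t₁ ∈ Finset.range (N + 1), ∑ t₂ ∈ Finset.range (N + 1), ∑ t₃ ∈ Finset.range (N + 1),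
        (if t₁ < 3 then (1 : ℝ) else 0) * (if t₂ < 3 then 1 else 0) * (if t₃ < 3 then 1 else 0) := by
        refine Finset.sum_le_sum fun t₁ _ => Finset.sum_le_sum fun t₂ _ =>
          Finset.sum_le_sum fun t₃ _ => ?_
        split_ifs <;> first | omega | norm_num
    _ = (∑ t ∈ Finset.range (N + 1), if t < 3 then (1 : ℝ) else 0) ^ 3 := by
        simp only [← Finset.mul_sum, ← Finset.sum_mul]
        ring
    _ ≤ 3 ^ 3 := pow_le_pow_left₀ h0 h3 3
    _ = 27 := by norm_num

/-- The full open triangle is the restricted one up to short loops. -/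
lemma sum_nbwGreen_triple_le (htrans : IsTransitive G) (hdeg : ∀ x, deg G x = m) (hm : 2 ≤ m)
    (N : ℕ) {x y : V} (hxy : x ≠ y) :
    ∑ u, ∑ v, nbwGreen G N x u * nbwGreen G N u v * nbwGreen G N v y ≤
      nbwTriangle G N x y + 27 / ((m : ℝ) - 1) := by
  have hm2 : (2 : ℝ) ≤ m := by exact_mod_cast hm
  have hm1 : 0 ≤ 1 / ((m : ℝ) - 1) := by
    have : 0 < (m : ℝ) - 1 := by linarith
    positivity
  rw [sum_nbwGreen_triple_eq, nbwTriangle_eq]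
  calc _ ≤ ∑ t₁ ∈ Finset.range (N + 1), ∑ t₂ ∈ Finset.range (N + 1),
        ∑ t₃ ∈ Finset.range (N + 1), ((if 3 ≤ t₁ + t₂ + t₃ then
          ∑ u, ∑ v, nbwProb G t₁ x u * nbwProb G t₂ u v * nbwProb G t₃ v y else 0) +
          1 / ((m : ℝ) - 1) * if 3 ≤ t₁ + t₂ + t₃ then (0 : ℝ) else 1) := by
        refine Finset.sum_le_sum fun t₁ _ => Finset.sum_le_sum fun t₂ _ =>
          Finset.sum_le_sum fun t₃ _ => ?_
        split_ifs
        · simp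
        · simpa using sum_nbwProb_triple_le htrans hdeg hm t₁ t₂ t₃ hxy
    _ ≤ _ := by
        simp only [Finset.sum_add_distrib, ← Finset.mul_sum]
        have := mul_le_mul_of_nonneg_left (sum_ite_lt_three_le N) hm1
        have e : (27 : ℝ) / ((m : ℝ) - 1) = 1 / ((m : ℝ) - 1) * 27 := by ring
        rw [e]
        linarith

/-- The total mass of the non-backtracking triangle. -/
lemma le_sum_nbwTriangle (hdeg : ∀ x, deg G x = m) (hm : 2 ≤ m) (N : ℕ) (x : V) :
    ((N : ℝ) + 1) ^ 3 - 27 ≤ ∑ y, nbwTriangle G N x y := by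
  have rows := fun t x => sum_nbwProb (G := G) hdeg hm t x
  have h : ∑ y, nbwTriangle G N x y = ∑ t₁ ∈ Finset.range (N + 1), ∑ t₂ ∈ Finset.range (N + 1),
        ∑ t₃ ∈ Finset.range (N + 1), (1 - if 3 ≤ t₁ + t₂ + t₃ then (0 : ℝ) else 1) := by
    simp only [nbwTriangle_eq,
      Finset.sum_comm (s := (Finset.univ : Finset V)) (t := Finset.range (N + 1))]
    refine Finset.sum_congr rfl fun t₁ _ => Finset.sum_congr rfl fun t₂ _ =>
      Finset.sum_congr rfl fun t₃ _ => ?_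
    split_ifs
    · rw [Finset.sum_comm]
      have : ∀ u, ∑ y, ∑ v, nbwProb G t₁ x u * nbwProb G t₂ u v * nbwProb G t₃ v y =
          nbwProb G t₁ x u := by
        intro u
        rw [Finset.sum_comm]
        simp only [← Finset.mul_sum, rows, mul_one]
      simp only [this, rows, sub_zero]
    · simp
  rw [h]
  simp only [Finset.sum_sub_distrib, Finset.sum_const, Finset.card_range, nsmul_eq_mul, mul_one]
  have := sum_ite_lt_three_le N
  push_cast
  linarith

open Classical in
/-- The weight of a walk of length `t` from `z` to `x` closed by a connection through a
neighbour of `x`. -/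
noncomputable def loopWeight (G : SimpleGraph V) (p : ℝ) (t : ℕ) (z : V) : ℝ :=
  p * ∑ x, ∑ x', if G.Adj x x' then
    ∑ a, nbwProb G t z x * conn G p z a * conn G p x' a else 0

lemma loopWeight_nonneg (hdeg : ∀ x, deg G x = m) (hm : 1 ≤ m) (h0 : 0 ≤ p) (h1 : p ≤ 1) (t : ℕ)
    (z : V) : 0 ≤ loopWeight G p t z := by
  refine mul_nonneg h0 (Finset.sum_nonneg fun x _ => Finset.sum_nonneg fun x' _ => ?_)
  split_ifs
  · exact Finset.sum_nonneg fun a _ => mul_nonneg (mul_nonneg (nbwProb_nonneg hdeg hm t z x)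
      (conn_nonneg h0 h1 _ _)) (conn_nonneg h0 h1 _ _)
  · exact le_rfl

lemma loopWeight_eq (htrans : IsTransitive G) (hdeg : ∀ x, deg G x = m) (t : ℕ) (z o : V) :
    loopWeight G p t z = loopWeight G p t o := by
  classical
  obtain ⟨φ, rfl⟩ := htrans o z
  rw [loopWeight, loopWeight, ← Equiv.sum_comp φ.toEquiv]
  congr 1
  refine Finset.sum_congr rfl fun x _ => ?_
  rw [← Equiv.sum_comp φ.toEquiv]
  refine Finset.sum_congr rfl fun x' _ => ?_
  rw [← Equiv.sum_comp φ.toEquiv]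
  have e : ∀ x, φ.toEquiv x = φ x := fun _ => rfl
  simp only [e, nbwProb_map hdeg, conn_map]
  exact ite_congr_iff φ.map_adj_iff _ _

/-- The loops have small total weight. -/
lemma sum_loopWeight_le (htrans : IsTransitive G) (hdeg : ∀ x, deg G x = m) (hm : 2 ≤ m)
    (h0 : 0 ≤ p) (h1 : p ≤ 1) {κ l T : ℝ} {N : ℕ} (hκ : 0 ≤ κ) (hl : 0 ≤ l)
    (hconn : ∀ x y, conn G p x y ≤ κ * nbwGreen G N x y + l)
    (hT : ∀ x y, x ≠ y →
      ∑ u, ∑ v, nbwGreen G N x u * nbwGreen G N u v * nbwGreen G N v y ≤ T) (o : V) :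
    ∑ t ∈ Finset.range (N + 1), loopWeight G p t o ≤
      p * m * (κ ^ 2 * T + ((N : ℝ) + 1) *
        (2 * κ * l * ((N : ℝ) + 1) + Fintype.card V * l ^ 2)) := by
  classical
  set M := nbwGreen G N with hM
  have hM0 : ∀ x y, 0 ≤ M x y := nbwGreen_nonneg hdeg (by omega) N
  set c := 2 * κ * l * ((N : ℝ) + 1) + Fintype.card V * l ^ 2
  have e1 : ∑ t ∈ Finset.range (N + 1), loopWeight G p t o = p * ∑ x, ∑ x', if G.Adj x x' then
      M o x * ∑ a, conn G p x' a * conn G p a o else 0 := by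
    simp only [loopWeight]
    rw [← Finset.mul_sum, Finset.sum_comm]
    congr 1
    refine Finset.sum_congr rfl fun x _ => ?_
    rw [Finset.sum_comm]
    refine Finset.sum_congr rfl fun x' _ => ?_
    split_ifs
    · rw [hM, nbwGreen, Finset.sum_mul]
      refine Finset.sum_congr rfl fun t _ => ?_
      rw [Finset.mul_sum]
      refine Finset.sum_congr rfl fun a _ => ?_
      rw [conn_comm o a]; ring
    · simp
  -- Expanding the two bounds on `conn`: the cross terms and the constant term are summed into `c`.
  have e2 : ∀ x', ∑ a, conn G p x' a * conn G p a o ≤ κ ^ 2 * (∑ a, M x' a * M a o) + c := by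
    intro x'
    calc ∑ a, conn G p x' a * conn G p a o
        ≤ ∑ a, (κ * M x' a + l) * (κ * M a o + l) :=
          Finset.sum_le_sum fun a _ => mul_le_mul (hconn _ _) (hconn _ _) (conn_nonneg h0 h1 _ _)
            (add_nonneg (mul_nonneg hκ (hM0 _ _)) hl)
      _ = ∑ a, (κ ^ 2 * (M x' a * M a o) + κ * l * M x' a + κ * l * M a o + l ^ 2) :=
          Finset.sum_congr rfl fun a _ => by ring
      _ = _ := by
          simp only [Finset.sum_add_distrib, ← Finset.mul_sum, Finset.sum_const, nsmul_eq_mul,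
            Finset.card_univ]
          rw [hM, sum_nbwGreen hdeg hm, sum_nbwGreen_left htrans hdeg hm]
          simp only [c]; ring
  -- Mass transport fixes `x` at `o` and sums over the start of the walk instead. What remains is an
  -- open triangle between the neighbours x' and `o`, which are distinct.
  have e3 : ∑ x, ∑ x', (if G.Adj x x' then M o x * ∑ a, M x' a * M a o else 0) ≤ m * T := by
    let F : V → V → ℝ := fun z x => ∑ x', if G.Adj x x' then M z x * ∑ a, M x' a * M a z else 0
    have hF : ∀ (φ : G ≃g G) z x, F (φ z) (φ x) = F z x := by
      intro φ z x
      simp only [F]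
      rw [← Equiv.sum_comp φ.toEquiv]
      refine Finset.sum_congr rfl fun x' _ => ?_
      rw [← Equiv.sum_comp φ.toEquiv]
      have e : ∀ x, φ.toEquiv x = φ x := fun _ => rfl
      simp only [e, hM, nbwGreen_map hdeg]
      exact ite_congr_iff φ.map_adj_iff _ _
    rw [show ∑ x, ∑ x', (if G.Adj x x' then M o x * ∑ a, M x' a * M a o else 0) = ∑ x, F o x from
      rfl, sum_comm_of_invariant htrans hF o]
    calc ∑ z, F z o = ∑ x', if G.Adj o x' then
          ∑ a, ∑ z, M x' a * M a z * M z o else 0 := by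
          simp only [F]
          rw [Finset.sum_comm]
          refine Finset.sum_congr rfl fun x' _ => ?_
          split_ifs
          · rw [Finset.sum_comm]
            refine Finset.sum_congr rfl fun z _ => ?_
            rw [Finset.mul_sum]
            exact Finset.sum_congr rfl fun a _ => by ring
          · simp
      _ ≤ ∑ x', if G.Adj o x' then T else 0 := by
          refine Finset.sum_le_sum fun x' _ => ?_
          split_ifs with h
          · exact hT x' o h.ne'
          · exact le_rfl
      _ = m * T := by
          rw [← Finset.sum_filter, Finset.sum_const, nsmul_eq_mul, card_filter_adj hdeg]
  rw [e1, mul_assoc]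
  refine mul_le_mul_of_nonneg_left ?_ h0
  calc ∑ x, ∑ x', (if G.Adj x x' then M o x * ∑ a, conn G p x' a * conn G p a o else 0)
      ≤ ∑ x, ∑ x', (κ ^ 2 * (if G.Adj x x' then M o x * ∑ a, M x' a * M a o else 0) +
          if G.Adj x x' then M o x * c else 0) := by
        refine Finset.sum_le_sum fun x _ => Finset.sum_le_sum fun x' _ => ?_
        split_ifs
        · have := mul_le_mul_of_nonneg_left (e2 x') (hM0 o x)
          linarith
        · simp
    _ = κ ^ 2 * (∑ x, ∑ x', if G.Adj x x' then M o x * ∑ a, M x' a * M a o else 0) +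
          m * (((N : ℝ) + 1) * c) := by
        simp only [Finset.sum_add_distrib, ← Finset.mul_sum]
        congr 1
        have : ∀ x, ∑ x', (if G.Adj x x' then M o x * c else 0) = m * (M o x * c) := by
          intro x
          rw [← Finset.sum_filter, Finset.sum_const, nsmul_eq_mul, card_filter_adj hdeg]
        simp only [this]
        rw [← Finset.mul_sum, ← Finset.sum_mul, hM, sum_nbwGreen hdeg hm]
    _ ≤ κ ^ 2 * (m * T) + m * (((N : ℝ) + 1) * c) := by
        have := mul_le_mul_of_nonneg_left e3 (sq_nonneg κ)
        linarith
    _ = _ := by ring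

/-- The gluing error is small, given a priori bounds on the sphere masses. -/
lemma glueError_le (htrans : IsTransitive G) (hdeg : ∀ x, deg G x = m) (hm : 2 ≤ m) (h0 : 0 ≤ p)
    (h2 : p ≤ 1 / 2) {κ q : ℝ} {N : ℕ} (hκ1 : 1 ≤ κ)
    (hκ : ∀ t < N, p ^ (t + 1) * m * ((m : ℝ) - 1) ^ t ≤ κ)
    (hq : ∀ x y, nbwProb G N x y ≤ q) {g : ℝ} (hg0 : 0 ≤ g) {r : ℕ}
    (hg : ∀ s ≤ r, ∀ x A, sphereMass G p x s A ≤ g) (A : Set V) (o : V) :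
    glueError G p A o r ≤ g * (κ * ∑ t ∈ Finset.range (N + 1), loopWeight G p t o +
      ((r : ℝ) + 1) * (g * (κ * q * (p * m) * (∑ y, conn G p o y) ^ 2))) := by
  classical
  have h1 : p ≤ 1 := by linarith
  have hκ0 : 0 ≤ κ := by linarith
  have hm1 : 1 ≤ m := by omega
  set χ := ∑ y, conn G p o y with hχ
  have hq0 : 0 ≤ q := (nbwProb_nonneg hdeg hm1 N o o).trans (hq o o)
  set l := κ * q * (p * m) * χ ^ 2 with hl
  have hl0 : 0 ≤ l := by positivity
  -- The part of the tree beyond `w`: a path to `x`, an edge to x', and connections from `z` and x'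
  -- to a common vertex.
  let L : ℕ → V → V → ℝ := fun t z w => p * ∑ x, ∑ x', if G.Adj x x' then
    ∑ a, prob G p (PathOfLength t w x) * conn G p z a * conn G p x' a else 0
  have hL0 : ∀ t z w, 0 ≤ L t z w := fun t z w => by
    refine mul_nonneg h0 (Finset.sum_nonneg fun x _ => Finset.sum_nonneg fun x' _ => ?_)
    split_ifs
    · exact Finset.sum_nonneg fun a _ => mul_nonneg (mul_nonneg (prob_nonneg h0 h1 _)
        (conn_nonneg h0 h1 _ _)) (conn_nonneg h0 h1 _ _)
    · exact le_rfl
  have hL1 : ∀ t ≤ N, ∀ z, L t z z ≤ κ * loopWeight G p t z := by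
    intro t ht z
    simp only [L]
    rw [loopWeight, mul_left_comm]
    refine mul_le_mul_of_nonneg_left ?_ h0
    rw [Finset.mul_sum]
    refine Finset.sum_le_sum fun x _ => ?_
    rw [Finset.mul_sum]
    refine Finset.sum_le_sum fun x' _ => ?_
    split_ifs
    · rw [Finset.mul_sum]
      refine Finset.sum_le_sum fun a _ => ?_
      rw [← mul_assoc, ← mul_assoc]
      exact mul_le_mul_of_nonneg_right (mul_le_mul_of_nonneg_right
        (prob_pathOfLength_le hdeg hm h0 h2 hκ1 hκ ht z x) (conn_nonneg h0 h1 _ _))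
        (conn_nonneg h0 h1 _ _)
    · simp
  -- Long branch: the path has probability at most κ q whatever its end. The sums over `x`, x' and
  -- `a` then give m, χ and χ.
  have hL2 : ∀ z w, L N z w ≤ l := by
    intro z w
    have : L N z w ≤ p * ∑ x, ∑ x', if G.Adj x' x then
        ∑ a, (κ * q) * conn G p z a * conn G p x' a else 0 := by
      refine mul_le_mul_of_nonneg_left ?_ h0
      refine Finset.sum_le_sum fun x _ => Finset.sum_le_sum fun x' _ => ?_
      by_cases h : G.Adj x x'
      · rw [if_pos h, if_pos h.symm]
        refine Finset.sum_le_sum fun a _ => ?_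
        exact mul_le_mul_of_nonneg_right (mul_le_mul_of_nonneg_right
          ((prob_pathOfLength_le hdeg hm h0 h2 hκ1 hκ le_rfl w x).trans
            (mul_le_mul_of_nonneg_left (hq w x) hκ0)) (conn_nonneg h0 h1 _ _))
          (conn_nonneg h0 h1 _ _)
      · rw [if_neg h, if_neg fun h' => h h'.symm]
    refine this.trans_eq ?_
    rw [Finset.sum_comm]
    have e : ∀ x', ∑ x, (if G.Adj x' x then ∑ a, (κ * q) * conn G p z a * conn G p x' a else 0) =
        m * ∑ a, (κ * q) * conn G p z a * conn G p x' a := by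
      intro x'
      rw [← Finset.sum_filter, Finset.sum_const, nsmul_eq_mul, card_filter_adj hdeg]
    simp only [e]
    rw [← Finset.mul_sum, Finset.sum_comm]
    have e' : ∀ a, ∑ x', (κ * q) * conn G p z a * conn G p x' a = (κ * q) * conn G p z a * χ := by
      intro a
      rw [← Finset.mul_sum, hχ, ← sum_conn_eq htrans a o]
      simp only [conn_comm a]
    simp only [e']
    rw [← Finset.sum_mul, ← Finset.mul_sum, sum_conn_eq htrans z o, ← hχ, hl]
    ring
  have step1 : glueError G p A o r ≤ ∑ s ∈ Finset.range (r + 1), ∑ z, ∑ w,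
      prob G p (OnGeodesic A o z w s (r - s - min (r - s) N)) * L (min (r - s) N) z w := by
    calc glueError G p A o r ≤ p * ∑ x, ∑ x', if G.Adj x x' then ∑ a,
          (∑ s ∈ Finset.range (r + 1), ∑ z, ∑ w,
            prob G p (OnGeodesic A o z w s (r - s - min (r - s) N)) *
            (prob G p (PathOfLength (min (r - s) N) w x) * conn G p z a)) * conn G p x' a
            else 0 := by
          refine mul_le_mul_of_nonneg_left ?_ h0
          refine Finset.sum_le_sum fun x _ => Finset.sum_le_sum fun x' _ => ?_
          split_ifs
          · exact Finset.sum_le_sum fun a _ => mul_le_mul_of_nonneg_right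
              (prob_edist_and_reachable_le h0 h2 A o x a r N) (conn_nonneg h0 h1 _ _)
          · exact le_rfl
      _ = _ := by
          simp only [L, ← Finset.sum_filter, Finset.mul_sum, Finset.sum_mul]
          -- Pure interchange of sums.
          have hc : ∀ (f : V → V → V → ℕ → V → V → ℝ) (S : V → Finset V),
              ∑ x, ∑ x' ∈ S x, ∑ a, ∑ s ∈ Finset.range (r + 1), ∑ z, ∑ w, f x x' a s z w =
              ∑ s ∈ Finset.range (r + 1), ∑ z, ∑ w, ∑ x, ∑ x' ∈ S x, ∑ a, f x x' a s z w := by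
            intro f S
            have t1 : ∀ x x', ∑ a, ∑ s ∈ Finset.range (r + 1), ∑ z, ∑ w, f x x' a s z w =
                ∑ s ∈ Finset.range (r + 1), ∑ z, ∑ w, ∑ a, f x x' a s z w := by
              intro x x'
              rw [Finset.sum_comm]
              refine Finset.sum_congr rfl fun s _ => ?_
              rw [Finset.sum_comm]
              exact Finset.sum_congr rfl fun z _ => Finset.sum_comm
            have t2 : ∀ x, ∑ x' ∈ S x, ∑ s ∈ Finset.range (r + 1), ∑ z, ∑ w, ∑ a, f x x' a s z w =
                ∑ s ∈ Finset.range (r + 1), ∑ z, ∑ w, ∑ x' ∈ S x, ∑ a, f x x' a s z w := by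
              intro x
              rw [Finset.sum_comm]
              refine Finset.sum_congr rfl fun s _ => ?_
              rw [Finset.sum_comm]
              exact Finset.sum_congr rfl fun z _ => Finset.sum_comm
            simp only [t1, t2]
            rw [Finset.sum_comm]
            refine Finset.sum_congr rfl fun s _ => ?_
            rw [Finset.sum_comm]
            exact Finset.sum_congr rfl fun z _ => Finset.sum_comm
          rw [hc]
          refine Finset.sum_congr rfl fun s _ => Finset.sum_congr rfl fun z _ =>
            Finset.sum_congr rfl fun w _ => Finset.sum_congr rfl fun x _ =>
            Finset.sum_congr rfl fun x' _ => Finset.sum_congr rfl fun a _ => by ring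
  let b : ℕ → ℝ := fun t => if t ≤ N then κ * loopWeight G p t o else 0
  have hb0 : ∀ t, 0 ≤ b t := fun t => by
    simp only [b]
    split_ifs
    · exact mul_nonneg hκ0 (loopWeight_nonneg hdeg hm1 h0 h1 t o)
    · exact le_rfl
  have step2 : ∀ s ∈ Finset.range (r + 1), ∀ z, ∑ w,
      prob G p (OnGeodesic A o z w s (r - s - min (r - s) N)) * L (min (r - s) N) z w ≤
      prob G p (fun ω => (off ω A).edist o z = s) * (b (r - s) + g * l) := by
    intro s hs z
    have hd0 := prob_nonneg (G := G) h0 h1 (fun ω => (off ω A).edist o z = s)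
    by_cases hN : r - s ≤ N
    · rw [min_eq_left hN, Nat.sub_self]
      -- Short branch: the middle piece has length zero, so only w = z contributes.
      rw [Finset.sum_eq_single z]
      · refine mul_le_mul (prob_mono h0 h1 fun ω _ h => h.1) ?_ (hL0 _ _ _) hd0
        simp only [b, if_pos hN]
        have := hL1 (r - s) hN z
        rw [loopWeight_eq htrans hdeg _ z o] at this
        have : 0 ≤ g * l := mul_nonneg hg0 hl0
        linarith
      · intro w _ hw
        rw [prob_false, zero_mul]
        rintro ω _ ⟨-, -, h⟩
        have h' : (off ω A).edist z w = 0 := by simpa using h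
        exact hw (SimpleGraph.edist_eq_zero_iff.1 h').symm
      · simp
    · push Not at hN
      rw [min_eq_right hN.le]
      calc _ ≤ ∑ w, prob G p (OnGeodesic A o z w s (r - s - N)) * l :=
            Finset.sum_le_sum fun w _ => mul_le_mul_of_nonneg_left (hL2 z w) (prob_nonneg h0 h1 _)
        _ = (∑ w, prob G p (OnGeodesic A o z w s (r - s - N))) * l := by rw [Finset.sum_mul]
        -- The middle piece restarts afresh from `z`, giving one further factor `g`.
        _ ≤ prob G p (fun ω => (off ω A).edist o z = s) * g * l :=
            mul_le_mul_of_nonneg_right (sum_prob_onGeodesic_le h0 h1 A o z s (r - s - N)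
              fun A' => hg _ (by omega) z A') hl0
        _ ≤ _ := by
            rw [mul_assoc]
            refine mul_le_mul_of_nonneg_left ?_ hd0
            have := hb0 (r - s)
            linarith
  calc glueError G p A o r ≤ _ := step1
    _ ≤ ∑ s ∈ Finset.range (r + 1), ∑ z,
        prob G p (fun ω => (off ω A).edist o z = s) * (b (r - s) + g * l) :=
        Finset.sum_le_sum fun s hs => Finset.sum_le_sum fun z _ => step2 s hs z
    _ ≤ ∑ s ∈ Finset.range (r + 1), g * (b (r - s) + g * l) := by
        refine Finset.sum_le_sum fun s hs => ?_
        rw [← Finset.sum_mul]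
        exact mul_le_mul_of_nonneg_right
          (hg s (Nat.lt_succ_iff.1 (Finset.mem_range.1 hs)) o A)
          (add_nonneg (hb0 _) (mul_nonneg hg0 hl0))
    _ = g * (∑ t ∈ Finset.range (r + 1), b t + ((r : ℝ) + 1) * (g * l)) := by
        rw [← Finset.mul_sum, Finset.sum_add_distrib, Finset.sum_const, Finset.card_range,
          nsmul_eq_mul]
        have := Finset.sum_range_reflect b (r + 1)
        simp only [Nat.add_sub_cancel] at this
        rw [this]
        push_cast; rfl
    _ ≤ _ := by
        refine mul_le_mul_of_nonneg_left (add_le_add ?_ le_rfl) hg0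
        rw [Finset.mul_sum]
        calc ∑ t ∈ Finset.range (r + 1), b t
            = ∑ t ∈ (Finset.range (r + 1)).filter (· ≤ N), κ * loopWeight G p t o := by
              rw [Finset.sum_filter]
          _ ≤ _ := by
              refine Finset.sum_le_sum_of_subset_of_nonneg (fun t ht => ?_) fun t _ _ =>
                mul_nonneg hκ0 (loopWeight_nonneg hdeg hm1 h0 h1 t o)
              exact Finset.mem_range.2 (Nat.lt_succ_of_le (Finset.mem_filter.1 ht).2)

end ErrorBounds

/-! ### The bootstrap up to the critical scale, and the pigeonhole beyond it. -/

section Bootstrap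

variable {V : Type*} [Fintype V] {G : SimpleGraph V} {p : ℝ} {m : ℕ}

lemma sphereMass_zero_le (h0 : 0 ≤ p) (h1 : p ≤ 1) (x : V) (A : Set V) :
    sphereMass G p x 0 A ≤ 1 := by
  rw [sphereMass, Finset.sum_eq_single x]
  · exact prob_le_one h0 h1 _
  · intro y _ hy
    refine prob_false fun ω _ h => hy ?_
    have h' : (off ω A).edist x y = 0 := by simpa using h
    exact (SimpleGraph.edist_eq_zero_iff.1 h').symm
  · simp

lemma sphereMass_one_le (hdeg : ∀ x, deg G x = m) (h0 : 0 ≤ p) (h1 : p ≤ 1) (x : V)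
    (A : Set V) : sphereMass G p x 1 A ≤ p * m := by
  classical
  calc sphereMass G p x 1 A ≤ ∑ y, if G.Adj x y then p else 0 := by
        refine Finset.sum_le_sum fun y _ => ?_
        refine (prob_mono h0 h1 (Y := fun ω => ω.Adj x y) fun ω _ h => ?_).trans
          ((prob_adj_le h0 x y).trans_eq (ite_congr_iff Iff.rfl _ _))
        have h' : (off ω A).edist x y = 1 := by simpa using h
        exact off_le ω A (SimpleGraph.edist_eq_one_iff_adj.1 h')
    _ = p * m := by
        rw [← Finset.sum_filter, Finset.sum_const, nsmul_eq_mul, card_filter_adj hdeg, mul_comm]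

/-- Spheres of different radii are disjoint subsets of the cluster. -/
lemma sum_sphereMass_le (h0 : 0 ≤ p) (h1 : p ≤ 1) (x : V) (A : Set V) (S : Finset ℕ) :
    ∑ s ∈ S, sphereMass G p x s A ≤ ∑ y, conn G p x y := by
  classical
  simp only [sphereMass]
  rw [Finset.sum_comm]
  refine Finset.sum_le_sum fun y _ => ?_
  simp only [prob, conn]
  rw [← expect_sum]
  refine expect_mono h0 h1 fun ω _ => ?_
  by_cases h : ∃ s ∈ S, (off ω A).edist x y = (s : ℕ∞)
  · obtain ⟨s, hs, h⟩ := h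
    have hr : ω.Reachable x y :=
      (SimpleGraph.reachable_of_edist_ne_top (by rw [h]; exact ENat.natCast_ne_top _)).mono
        (off_le ω A)
    rw [Finset.sum_eq_single s, if_pos h, if_pos hr]
    · intro t _ ht
      rw [if_neg]
      intro h'
      rw [h] at h'
      exact ht (by exact_mod_cast h'.symm)
    · exact fun h => absurd hs h
  · push Not at h
    rw [Finset.sum_eq_zero fun s hs => by rw [if_neg (h s hs)]]
    positivity

lemma sphereMass_le_card (h0 : 0 ≤ p) (h1 : p ≤ 1) (x : V) (r : ℕ) (A : Set V) :
    sphereMass G p x r A ≤ Fintype.card V := by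
  rw [sphereMass]
  refine (Finset.sum_le_sum fun y _ => prob_le_one h0 h1 _).trans_eq ?_
  simp

/-- The sphere masses are bounded when the non-backtracking walk mixes before the critical
time scale `|V| ^ (1 / 3)`. -/
theorem sphereMass_le_of_mixing (htrans : IsTransitive G) (hdeg : ∀ x, deg G x = m) (hm : 2 ≤ m)
    (h0 : 0 ≤ p) (h2 : p ≤ 1 / 2) (o : V) {N : ℕ} {c T : ℝ} (hc : 100 ≤ c)
    (hc3 : c ^ 3 = Fintype.card V) (hχ : ∑ y, conn G p o y = c / 10)
    (hpm : 99 / 100 ≤ p * m) (hpm' : p * m ≤ 26 / 25)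
    (hκ : ∀ t < N, p ^ (t + 1) * m * ((m : ℝ) - 1) ^ t ≤ 2)
    (hq : ∀ x y, nbwProb G N x y ≤ 101 / 50 / c ^ 3) (hN : (N : ℝ) + 1 ≤ c / 1000)
    (hT : ∀ x y, x ≠ y →
      ∑ u, ∑ v, nbwGreen G N x u * nbwGreen G N u v * nbwGreen G N v y ≤ T)
    (hT' : T ≤ 1 / 1000) (r : ℕ) (x : V) (A : Set V) : sphereMass G p x r A ≤ 6 / 5 := by
  have h1 : p ≤ 1 := by linarith
  have hc0 : 0 < c := by linarith
  have hχx : ∀ x, ∑ y, conn G p x y = c / 10 := fun x => by rw [sum_conn_eq htrans x o, hχ]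
  -- This is κ q χ with κ = 2, q = (101/50) / c³ and χ = c/10.
  set l : ℝ := 101 / 250 / c ^ 2 with hl
  have hl0 : 0 ≤ l := by positivity
  have hconn : ∀ x y, conn G p x y ≤ 2 * nbwGreen G N x y + l := by
    intro x y
    refine (conn_le htrans hdeg hm h0 h2 one_le_two hκ hq o x y).trans_eq ?_
    rw [hχ, nbwGreen, hl]
    congr 1
    field_simp
    norm_num
  have hloop : ∀ x, ∑ t ∈ Finset.range (N + 1), loopWeight G p t x ≤ 1 / 100 := by
    intro x
    refine (sum_loopWeight_le htrans hdeg hm h0 h1 zero_le_two hl0 hconn hT x).trans ?_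
    have hN0 : (0 : ℝ) ≤ (N : ℝ) + 1 := by positivity
    have a1 : ((N : ℝ) + 1) * (2 * 2 * l * ((N : ℝ) + 1) + Fintype.card V * l ^ 2) ≤
        (c / 1000) * (2 * 2 * l * (c / 1000) + Fintype.card V * l ^ 2) := by
      gcongr
    have a2 : (c / 1000) * (2 * 2 * l * (c / 1000) + Fintype.card V * l ^ 2) =
        (1 / 1000) * (4 * (101 / 250) / 1000 + (101 / 250) ^ 2) := by
      rw [← hc3, hl]; field_simp; norm_num
    rw [a2] at a1
    have a3 : 2 ^ 2 * T + ((N : ℝ) + 1) *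
        (2 * 2 * l * ((N : ℝ) + 1) + Fintype.card V * l ^ 2) ≤ 9 / 1000 := by
      norm_num at a1 ⊢
      linarith
    calc _ ≤ p * m * (9 / 1000) := mul_le_mul_of_nonneg_left a3 (by positivity)
      _ ≤ _ := by linarith
  have small : ∀ r : ℕ, (r : ℝ) ≤ c + 1 → ∀ x A, sphereMass G p x r A ≤ 6 / 5 := by
    intro r
    induction r using Nat.strong_induction_on with
    | _ r ih =>
      intro hr x A
      -- The bound at `r` itself is a priori: one step from level r - 1 gives 6/5 · 26/25 < 5/4.
      have hg : ∀ s ≤ r, ∀ x A, sphereMass G p x s A ≤ 5 / 4 := by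
        intro s hs x A
        rcases hs.lt_or_eq with h | rfl
        · have hsr : (s : ℝ) ≤ r := by exact_mod_cast hs
          exact (ih s h (by linarith) x A).trans (by norm_num)
        · cases s with
          | zero => exact (sphereMass_zero_le h0 h1 x A).trans (by norm_num)
          | succ s =>
            have b1 := sphereMass_add_le h0 h1 A x s 1 (sphereMass_one_le hdeg h0 h1)
            have b2 := ih s (Nat.lt_succ_self s) (by push_cast at hr; linarith) x A
            have b3 : sphereMass G p x s A * (p * m) ≤ 6 / 5 * (26 / 25) :=
              mul_le_mul b2 hpm' (by positivity) (by norm_num)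
            linarith
      have b1 := mul_sphereMass_le_one_add htrans hdeg h0 h2 A x r
      have b2 := glueError_le htrans hdeg hm h0 h2 one_le_two hκ hq (by norm_num) hg A x
      rw [hχx] at b2
      have b3 := hloop x
      -- Here r + 1 ≤ c + 2 ≤ (102/100) c because c ≥ 100.
      have b4 : ((r : ℝ) + 1) * (5 / 4 * (2 * (101 / 50 / c ^ 3) * (p * m) * (c / 10) ^ 2)) ≤
          (c * (102 / 100)) * (5 / 4 * (2 * (101 / 50 / c ^ 3) * (26 / 25) * (c / 10) ^ 2)) := by
        gcongr
        linarith
      have b5 : (c * (102 / 100)) * (5 / 4 * (2 * (101 / 50 / c ^ 3) * (26 / 25) * (c / 10) ^ 2)) =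
          (102 / 100) * (5 / 4 * (2 * (101 / 50) * (26 / 25) / 100)) := by
        field_simp; norm_num
      rw [b5] at b4
      -- The error is at most 5/4 · (2/100 + 0.054) < 1/10.
      have b6 : p * m * sphereMass G p x r A ≤ 11 / 10 := by
        norm_num at b2 b4 ⊢
        linarith
      by_contra hcon
      push Not at hcon
      have b7 : 99 / 100 * (6 / 5 : ℝ) ≤ p * m * sphereMass G p x r A :=
        mul_le_mul hpm hcon.le (by norm_num) (by positivity)
      norm_num at b7
      linarith
  induction r using Nat.strong_induction_on generalizing x A with
  | _ r ih =>
    by_cases hr : (r : ℝ) ≤ c + 1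
    · exact small r hr x A
    · push Not at hr
      have hR1 : c ≤ ⌈c⌉₊ := Nat.le_ceil c
      have hR2 : (⌈c⌉₊ : ℝ) < c + 1 := Nat.ceil_lt_add_one hc0.le
      -- Levels 1 to ⌈c⌉ share a total mass of at most c/10, so one of them has mass at most 1/10.
      -- Starting at 1 makes r - s smaller than r.
      have hsum : ∑ s ∈ Finset.Icc 1 ⌈c⌉₊, sphereMass G p x s A ≤
          ∑ _s ∈ Finset.Icc 1 ⌈c⌉₊, (1 / 10 : ℝ) := by
        refine (sum_sphereMass_le h0 h1 x A _).trans ?_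
        rw [hχx, Finset.sum_const, Nat.card_Icc, nsmul_eq_mul]
        simp only [Nat.add_sub_cancel]
        linarith
      have hne : (Finset.Icc 1 ⌈c⌉₊).Nonempty :=
        Finset.nonempty_Icc.2 (Nat.one_le_iff_ne_zero.2 (Nat.ceil_pos.2 hc0).ne')
      obtain ⟨s, hs, hs'⟩ := Finset.exists_le_of_sum_le hne hsum
      obtain ⟨hs1, hs2⟩ := Finset.mem_Icc.1 hs
      have hsr : s < r := by
        have : (s : ℝ) ≤ ⌈c⌉₊ := by exact_mod_cast hs2
        have : (s : ℝ) < r := by linarith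
        exact_mod_cast this
      have b := sphereMass_add_le h0 h1 A x s (r - s) (g := 6 / 5)
        fun z A' => ih (r - s) (by omega) z A'
      rw [Nat.add_sub_cancel' hsr.le] at b
      linarith

end Bootstrap

/-! ### From the hypotheses on one graph to the numerical inputs of the bootstrap. -/

section Mixing

variable {V : Type*} [Fintype V] {G : SimpleGraph V} {p : ℝ} {m : ℕ}

lemma le_card_of_deg (x : V) (hdeg : deg G x = m) : m ≤ Fintype.card V := by
  rw [← hdeg, deg, ← Nat.card_eq_fintype_card]
  exact Set.ncard_le_card _

/-- A base whose `N`-th power is close to `1` has bounded powers up to `N`. -/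
lemma pow_le_of_pow_le {b η : ℝ} (hb : 0 ≤ b) (hη : 0 ≤ η) {N t : ℕ} (ht : t ≤ N)
    (h : b ^ N ≤ 1 + η) : b ^ t ≤ 1 + η := by
  rcases le_total b 1 with h1 | h1
  · exact (pow_le_one₀ hb h1).trans (by linarith)
  · exact (pow_le_pow_right₀ h1 ht).trans h

lemma le_base_of_le_pow {b η : ℝ} (hb : 0 ≤ b) (hη : 0 ≤ η) {N : ℕ} (hN : 1 ≤ N)
    (h : 1 - η ≤ b ^ N) : 1 - η ≤ b := by
  rcases le_total b 1 with h1 | h1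
  · exact h.trans ((pow_le_pow_of_le_one hb h1 hN).trans_eq (pow_one b))
  · linarith

/-- The uniform bound on expected sphere sizes for a single graph. -/
theorem sphereMass_le_of_isCriticalProb (htrans : IsTransitive G) (hdeg : ∀ x, deg G x = m)
    {o : V} (hp : IsCriticalProb G o (1 / 10) p) {α K : ℝ} {N : ℕ}
    (hα : α ≤ 1 / 100) (hmix : IsUniformMixingTime G α N) (hm : 10 ^ 12 ≤ m)
    (hpow : |(p * ((m : ℝ) - 1)) ^ N - 1| ≤ 1 / 100)
    (htri : ∀ x y, nbwTriangle G N x y ≤ K * α) (hKα : K * α ≤ 1 / (2 * 10 ^ 9))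
    (r : ℕ) (x : V) (A : Set V) : sphereMass G p x r A ≤ 6 / 5 := by
  obtain ⟨h0, h1, hχ⟩ := hp
  have hm2 : 2 ≤ m := le_trans (by norm_num) hm
  have hmR : (10 : ℝ) ^ 12 ≤ m := by exact_mod_cast hm
  have hmV : (m : ℝ) ≤ Fintype.card V := by exact_mod_cast le_card_of_deg o (hdeg o)
  set v : ℝ := (Fintype.card V : ℝ) with hv
  have hv0 : 0 < v := by linarith [show (0 : ℝ) < 10 ^ 12 by norm_num]
  set c : ℝ := v ^ (1 / 3 : ℝ) with hc
  have hc0 : 0 ≤ c := Real.rpow_nonneg hv0.le _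
  have hc3 : c ^ 3 = v := by
    rw [hc, ← Real.rpow_natCast, ← Real.rpow_mul hv0.le]
    norm_num
  have hc100 : 100 ≤ c := by
    refine le_of_pow_le_pow_left₀ (n := 3) (by norm_num) hc0 ?_
    rw [hc3]
    refine le_trans ?_ (hmR.trans hmV)
    norm_num
  have hmix1 := hmix.1
  have nn := fun t x y => nbwProb_nonneg (G := G) hdeg (by omega : 1 ≤ m) t x y
  -- At time 0 the average on the diagonal is at least 1/2, far above (1 + α) / V.
  have hN1 : 1 ≤ N := by
    rw [Nat.one_le_iff_ne_zero]
    rintro rfl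
    have e1 := hmix1 o o
    have e2 := nn 1 o o
    have e3 : nbwProb G 0 o o = 1 := by simp [nbwProb]
    rw [e3] at e1
    have e4 : (1 + α) * v⁻¹ ≤ 2 * (1 / 10 ^ 12) := by
      refine mul_le_mul (by linarith) ?_ (by positivity) (by norm_num)
      rw [← one_div]
      exact one_div_le_one_div_of_le (by norm_num) (hmR.trans hmV)
    norm_num at e4 e1
    linarith
  -- Passing from the average over two times to a single time costs a factor 2.
  have hq : ∀ x y, nbwProb G N x y ≤ 101 / 50 / c ^ 3 := by
    intro x y
    have e1 := hmix1 x y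
    have e2 := nn (N + 1) x y
    have e3 : (1 + α) * v⁻¹ ≤ 101 / 100 * v⁻¹ :=
      mul_le_mul_of_nonneg_right (by linarith) (by positivity)
    rw [hc3, div_eq_mul_inv _ v]
    rw [← hv] at e1
    linarith
  -- The triangle condition makes the mixing time short: summed over y, it gives (N + 1)³ - 27 ≤ V /
  -- (2 · 10⁹), and the 27 is absorbed by V ≥ 10¹².
  have hN : (N : ℝ) + 1 ≤ c / 1000 := by
    refine le_of_pow_le_pow_left₀ (n := 3) (by norm_num) (by positivity) ?_
    have e1 := le_sum_nbwTriangle hdeg hm2 N o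
    have e2 : ∑ y, nbwTriangle G N o y ≤ v * (K * α) := by
      refine (Finset.sum_le_sum fun y _ => htri o y).trans_eq ?_
      simp [hv]
    have e3 : v * (K * α) ≤ v * (1 / (2 * 10 ^ 9)) := mul_le_mul_of_nonneg_left hKα hv0.le
    rw [div_pow, hc3]
    have e4 : (10 : ℝ) ^ 12 ≤ v := hmR.trans hmV
    norm_num at e3 e4 ⊢
    linarith
  set b : ℝ := p * ((m : ℝ) - 1) with hb
  have hb0 : 0 ≤ b := mul_nonneg h0 (by linarith [show (1 : ℝ) ≤ 10 ^ 12 by norm_num])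
  obtain ⟨hpow1, hpow2⟩ := abs_le.1 hpow
  have hb1 : 1 - 1 / 100 ≤ b := le_base_of_le_pow hb0 (by norm_num) hN1 (by linarith)
  have hb2 : b ≤ 1 + 1 / 100 := by
    have := pow_le_of_pow_le hb0 (η := 1 / 100) (by norm_num) hN1 (by linarith)
    rwa [pow_one] at this
  have hpm : p * m = b + p := by rw [hb]; ring
  have hp2 : p ≤ 1 / 100 := by
    by_contra hcon
    push Not at hcon
    have : 1 / 100 * ((10 : ℝ) ^ 12 - 1) ≤ b :=
      mul_le_mul hcon.le (by linarith) (by norm_num) h0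
    norm_num at this hb2
    linarith
  -- The weight is b^t · p m, and the N-th power of b controls all smaller ones.
  have hκ : ∀ t < N, p ^ (t + 1) * m * ((m : ℝ) - 1) ^ t ≤ 2 := by
    intro t ht
    have e1 := pow_le_of_pow_le hb0 (η := 1 / 100) (t := t) (by norm_num) ht.le (by linarith)
    have e2 : p ^ (t + 1) * m * ((m : ℝ) - 1) ^ t = b ^ t * (p * m) := by
      rw [hb, mul_pow]; ring
    rw [e2, hpm]
    calc b ^ t * (b + p) ≤ (1 + 1 / 100) * (1 + 1 / 100 + 1 / 100) :=
          mul_le_mul e1 (by linarith) (by linarith) (by norm_num)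
      _ ≤ 2 := by norm_num
  refine sphereMass_le_of_mixing (N := N) (c := c) (T := 1 / 1000) htrans hdeg hm2 h0
    (by linarith) o hc100 (by rw [hc3]) ?_ (by linarith) (by linarith) hκ hq hN ?_ le_rfl r x A
  · rw [← expectedClusterSize_eq_sum, hχ]; ring
  · intro x y hxy
    refine (sum_nbwGreen_triple_le htrans hdeg hm2 N hxy).trans ?_
    have e1 := htri x y
    have e2 : 27 / ((m : ℝ) - 1) ≤ 27 / ((10 : ℝ) ^ 12 - 1) :=
      div_le_div_of_nonneg_left (by norm_num) (by norm_num) (by linarith)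
    norm_num at e2 hKα ⊢
    linarith

end Mixing

end Perc

/-! ### From a single graph to the sequence. -/

theorem theorem4p1
    (V : ℕ → Type*) [∀ n, Fintype (V n)]
    (G : ∀ n, SimpleGraph (V n)) (o : ∀ n, V n)
    (m : ℕ → ℕ) (p α : ℕ → ℝ) (m₀ : ℕ → ℕ)
    (htrans : ∀ n, Perc.IsTransitive (G n))
    (hdeg : ∀ n x, Perc.deg (G n) x = m n)
    (hp : ∀ n, Perc.IsCriticalProb (G n) (o n) (1 / 10) (p n))
    (hα : Tendsto α atTop (𝓝 0))
    (hαm : ∀ n, 1 / (m n : ℝ) ≤ α n)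
    (hm₀ : ∀ n, Perc.IsUniformMixingTime (G n) (α n) (m₀ n))
    (h1 : Tendsto m atTop atTop)
    (h2 : (fun n => (p n * ((m n : ℝ) - 1)) ^ m₀ n - 1) =O[atTop] α)
    (h3 : ∃ K : ℝ, ∀ᶠ n in atTop, ∀ x y : V n,
      Perc.nbwTriangle (G n) (m₀ n) x y ≤ K * (α n / Real.log (Fintype.card (V n)))) :
    ∃ C : ℝ, 0 < C ∧ ∀ (n r : ℕ) (A : Set (V n)),
      Perc.expect (G n) (p n) (fun ω => ((Perc.sphereOff ω (o n) r A).ncard : ℝ)) ≤ C := by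
  obtain ⟨K, hK⟩ := h3
  have hα0 : ∀ n, 0 ≤ α n := fun n => le_trans (by positivity) (hαm n)
  have hKα : Tendsto (fun n => |K| * α n) atTop (𝓝 0) := by simpa using hα.const_mul |K|
  have hpow : Tendsto (fun n => (p n * ((m n : ℝ) - 1)) ^ m₀ n - 1) atTop (𝓝 0) :=
    h2.trans_tendsto hα
  have hev : ∀ᶠ n in atTop, ∀ (r : ℕ) (A : Set (V n)),
      Perc.sphereMass (G n) (p n) (o n) r A ≤ 6 / 5 := by
    filter_upwards [hK, hα.eventually (ge_mem_nhds (show (0 : ℝ) < 1 / 100 by norm_num)),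
      hKα.eventually (ge_mem_nhds (show (0 : ℝ) < 1 / (2 * 10 ^ 9) by norm_num)),
      h1.eventually_ge_atTop (10 ^ 12),
      hpow.eventually (Metric.closedBall_mem_nhds 0 (show (0 : ℝ) < 1 / 100 by norm_num))]
      with n e1 e2 e3 e4 e5 r A
    refine Perc.sphereMass_le_of_isCriticalProb (htrans n) (hdeg n) (hp n) e2 (hm₀ n) e4
      (by simpa [Real.dist_eq] using e5) (fun x y => ?_) e3 r (o n) A
    refine (e1 x y).trans ?_
    have hV : (10 : ℝ) ^ 12 ≤ Fintype.card (V n) := by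
      exact_mod_cast e4.trans (Perc.le_card_of_deg (o n) (hdeg n (o n)))
    -- So dividing by the logarithm only helps, and the triangle is at most |K| α.
    have hlog : 1 ≤ Real.log (Fintype.card (V n)) := by
      rw [Real.le_log_iff_exp_le (lt_of_lt_of_le (by norm_num) hV)]
      exact (Real.exp_one_lt_d9.le.trans (by norm_num)).trans hV
    have hd : 0 ≤ α n / Real.log (Fintype.card (V n)) := div_nonneg (hα0 n) (by linarith)
    calc K * (α n / Real.log (Fintype.card (V n)))
        ≤ |K| * (α n / Real.log (Fintype.card (V n))) :=
          mul_le_mul_of_nonneg_right (le_abs_self K) hd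
      _ ≤ |K| * α n :=
          mul_le_mul_of_nonneg_left (div_le_self (hα0 n) hlog) (abs_nonneg K)
  obtain ⟨n₀, hn₀⟩ := eventually_atTop.1 hev
  have hS : (0 : ℝ) ≤ ∑ k ∈ Finset.range n₀, (Fintype.card (V k) : ℝ) :=
    Finset.sum_nonneg fun _ _ => by positivity
  -- The finitely many small n are covered by the trivial bound, the number of vertices.
  refine ⟨6 / 5 + ∑ k ∈ Finset.range n₀, (Fintype.card (V k) : ℝ), by linarith, fun n r A => ?_⟩
  rw [Perc.expect_ncard_sphereOff]
  rcases lt_or_ge n n₀ with hn | hn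
  · have e1 := Perc.sphereMass_le_card (G := G n) (hp n).1 (hp n).2.1 (o n) r A
    have e2 := Finset.single_le_sum (f := fun k => (Fintype.card (V k) : ℝ))
      (fun _ _ => by positivity) (Finset.mem_range.2 hn)
    linarith
  · have := hn₀ n hn r A
    linarith
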